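/- Let $(\mathcal X,\mathcal A,\mu)$ be a $\sigma$-finite measure space and let $\{f_\theta:\theta\in\Theta\}$, $\Theta\subseteq\mathbb R^p$ open, be an identifiable family of probability densities with respect to $\mu$. Let $\beta\ge 0$ and put $$V_\theta(x)=\int f_\theta^{1+\beta}\,d\mu-\Bigl(1+\frac1\beta\Bigr)f_\theta^\beta(x)\quad(\beta>0),\qquad V_\theta(x)=-\log f_\theta(x)\quad(\beta=0).$$ Let $r<p$ and let $g:\mathbb R^p\to\mathbb R^r$ have on $\Theta$ a continuous $p\times r$ derivative matrix $G(\theta)=\partial g^T(\theta)/\partial\theta$ of rank $r$. Let $\Theta_0=\{\theta\in\Theta: g(\theta)=0\}$, let $\theta_0\in\Theta_0$, and let $X_1,X_2,\dots$ be i.i.d. with density $f_{\theta_0}$. Let $u_\theta(x)=\frac{\partial}{\partial\theta}\log f_\theta(x)$ and $$J_\beta(\theta)=\int u_\theta u_\theta^T f_\theta^{1+\beta}\,d\mu,\qquad \xi_\beta(\theta)=\int u_\theta f_\theta^{1+\beta}\,d\mu,\qquad K_\beta(\theta)=\int u_\theta u_\theta^T f_\theta^{1+2\beta}\,d\mu-\xi_\beta(\theta)\xi_\beta(\theta)^T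 .$$ Assume the Lehmann and Basu et al. conditions: 1. The support $\{x: f_\theta(x)>0\}$ is the same for all $\theta\in\Theta$. 2. There is an open set $\omega\subseteq\Theta$ containing $\theta_0$ such that, for almost all $x$ in the support, $\theta\mapsto f_\theta(x)$ is three times differentiable on $\omega$ with continuous third partial derivatives. 3. On $\omega$, the integrals $\int f_\theta^{1+\beta}\,d\mu$ and $\int f_\theta^{\beta}f_{\theta_0}\,d\mu$ exist and can be differentiated three times with respect to $\theta$, and the derivatives can be taken under the integral sign. 4. $J_\beta(\theta_0)$ is positive definite. 5. There are functions $M_{jkl}$ with $\int M_{jkl}f_{\theta_0}\,d\mu<\infty$ such that, for almost all $x$ in the support, $\bigl|\frac{\partial^3}{\partial\theta_j\partial\theta_k\partial\theta_l}V_\theta(x)\bigr|\le M_{jkl}(x)$ for all $\theta\in\omega$ and all $j,k,l$. Assume also that the integrals defining $K_\beta(\theta_0)$ are finite. Put $$Q=J_\beta^{-1}G\,(G^TJ_\beta^{-1}G)^{-1},\qquad P=J_\beta^{-1}-Q\,G^TJ_\beta^{-1},\qquad \Sigma=P K_\beta P,$$ all evaluated at $\theta_0$. Then the restricted minimum density power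 divergence estimator, i.e. the minimizer $\widetilde\theta_n$ of $\frac1n\sum_{i=1}^nV_\theta(X_i)$ subject to $g(\theta)=0$, satisfies $$\sqrt n\,(\widetilde\theta_n-\theta_0)\ \xrightarrow{\ \mathcal L\ }\ \mathcal N(0,\Sigma)$$ in the following sense. (a) There is $\rho_0>0$ such that for every $0<\rho\le\rho_0$: there are measurable functions of $(X_1,\dots,X_n)$ that, with probability tending to one, minimize $\frac1n\sum_{i=1}^n V_\theta(X_i)$ over $\{\theta\in\Theta_0:\|\theta-\theta_0\|\le\rho\}$; and every sequence of random vectors $\widetilde\theta_n$ with this minimizing property satisfies $\widetilde\theta_n\to\theta_0$ in probability and $\sqrt n(\widetilde\theta_n-\theta_0)\to\mathcal N(0,\Sigma)$ in law. (b) Every sequence of random vectors $\widetilde\theta_n$ which, with probability tending to one, belongs to $\Theta_0$ and is a (local or global) minimizer of $\frac1n\sum_{i=1}^nV_\theta(X_i)$ over $\Theta_0$, and which converges to $\theta_0$ in probability, satisfies $\sqrt n(\widetilde\theta_n-\theta_0)\to\mathcal N(0,\Sigma)$ in law. -/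

import Mathlib

open MeasureTheory ProbabilityTheory Filter Topology

noncomputable section

namespace DPD

/-- The parameter vectors live in `ℝᵖ` with its Euclidean structure. -/
abbrev E (p : ℕ) := EuclideanSpace ℝ (Fin p)

/-- The partial derivative `∂F/∂θ_j`, as a function of `θ`. -/
def pd {p : ℕ} (j : Fin p) (F : E p → ℝ) (θ : E p) : ℝ :=
  fderiv ℝ F θ (EuclideanSpace.single j 1)

/-- A sequence of events has probability tending to one (stated through the outer measure of the
complements, so that no measurability of the events is needed). -/
def WithHighProbability {Ω : Type*} [MeasurableSpace Ω] (P : Measure Ω)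
    (A : ℕ → Ω → Prop) : Prop :=
  Tendsto (fun n => P {w | ¬ A n w}) atTop (𝓝 0)

section Model

variable {p : ℕ} {𝒳 : Type*} [MeasurableSpace 𝒳]

/-- The probability measure with density `f_θ` with respect to `μ`. -/
def modelMeasure (μ : Measure 𝒳) (f : E p → 𝒳 → ℝ) (θ : E p) : Measure 𝒳 :=
  μ.withDensity (fun x => ENNReal.ofReal (f θ x))

/-- `(f_θ)`, `θ ∈ Θ`, is an identifiable family of probability densities with respect to `μ`,
with open parameter space `Θ ⊆ ℝᵖ`. -/
structure IsParametricModel (Θ : Set (E p)) (μ : Measure 𝒳) (f : E p → 𝒳 → ℝ) : Prop where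
  isOpen : IsOpen Θ
  measurable : ∀ θ ∈ Θ, Measurable (f θ)
  nonneg : ∀ θ ∈ Θ, ∀ x, 0 ≤ f θ x
  isProbabilityMeasure : ∀ θ ∈ Θ, IsProbabilityMeasure (modelMeasure μ f θ)
  identifiable : Set.InjOn (modelMeasure μ f) Θ

/-- `V_θ(x) = ∫ f_θ^{1+β} dμ - (1 + 1/β) f_θ(x)^β` for `β > 0`, and `-log f_θ(x)` for `β = 0`. -/
def V (μ : Measure 𝒳) (f : E p → 𝒳 → ℝ) (β : ℝ) (θ : E p) (x : 𝒳) : ℝ :=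
  if β = 0 then -Real.log (f θ x)
  else (∫ y, f θ y ^ (1 + β) ∂μ) - (1 + 1 / β) * f θ x ^ β

/-- The empirical objective function `(1/n) ∑ V_θ(xᵢ)`. -/
def objective (μ : Measure 𝒳) (f : E p → 𝒳 → ℝ) (β : ℝ) {n : ℕ} (x : Fin n → 𝒳)
    (θ : E p) : ℝ :=
  (1 / (n : ℝ)) * ∑ i, V μ f β θ (x i)

/-- The `j`-th component of the likelihood score `u_θ(x) = ∂ log f_θ(x) / ∂θ`. -/
def score (f : E p → 𝒳 → ℝ) (θ : E p) (x : 𝒳) (j : Fin p) : ℝ :=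
  pd j (fun t => Real.log (f t x)) θ

/-- `J_β(θ) = ∫ u_θ u_θᵀ f_θ^{1+β} dμ` (the form under the model). -/
def J (μ : Measure 𝒳) (f : E p → 𝒳 → ℝ) (β : ℝ) (θ : E p) : Matrix (Fin p) (Fin p) ℝ :=
  Matrix.of fun i j => ∫ x, score f θ x i * score f θ x j * f θ x ^ (1 + β) ∂μ

/-- `ξ_β(θ) = ∫ u_θ f_θ^{1+β} dμ`. -/
def xi (μ : Measure 𝒳) (f : E p → 𝒳 → ℝ) (β : ℝ) (θ : E p) (i : Fin p) : ℝ :=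
  ∫ x, score f θ x i * f θ x ^ (1 + β) ∂μ

/-- `K_β(θ) = ∫ u_θ u_θᵀ f_θ^{1+2β} dμ - ξ_β(θ) ξ_β(θ)ᵀ`. -/
def K (μ : Measure 𝒳) (f : E p → 𝒳 → ℝ) (β : ℝ) (θ : E p) : Matrix (Fin p) (Fin p) ℝ :=
  Matrix.of fun i j =>
    (∫ x, score f θ x i * score f θ x j * f θ x ^ (1 + 2 * β) ∂μ) - xi μ f β θ i * xi μ f β θ j

/-- The integral `∫ F_θ dμ` exists for `θ` in `s`, is three times differentiable with respect to
`θ` there, and its derivatives up to order three can be taken under the integral sign. -/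
structure ThriceDiffUnderIntegral (μ : Measure 𝒳) (F : E p → 𝒳 → ℝ) (s : Set (E p)) :
    Prop where
  integrable₀ : ∀ θ ∈ s, Integrable (F θ) μ
  integrable₁ : ∀ θ ∈ s, ∀ j, Integrable (fun x => pd j (fun t => F t x) θ) μ
  integrable₂ : ∀ θ ∈ s, ∀ j k, Integrable (fun x => pd j (pd k (fun t => F t x)) θ) μ
  integrable₃ : ∀ θ ∈ s, ∀ j k l,
    Integrable (fun x => pd j (pd k (pd l (fun t => F t x))) θ) μ
  differentiable₁ : DifferentiableOn ℝ (fun t => ∫ x, F t x ∂μ) s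
  differentiable₂ : ∀ l, DifferentiableOn ℝ (pd l (fun t => ∫ x, F t x ∂μ)) s
  differentiable₃ : ∀ k l, DifferentiableOn ℝ (pd k (pd l (fun t => ∫ x, F t x ∂μ))) s
  deriv₁ : ∀ θ ∈ s, ∀ j,
    pd j (fun t => ∫ x, F t x ∂μ) θ = ∫ x, pd j (fun t => F t x) θ ∂μ
  deriv₂ : ∀ θ ∈ s, ∀ j k,
    pd j (pd k (fun t => ∫ x, F t x ∂μ)) θ = ∫ x, pd j (pd k (fun t => F t x)) θ ∂μ
  deriv₃ : ∀ θ ∈ s, ∀ j k l,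
    pd j (pd k (pd l (fun t => ∫ x, F t x ∂μ))) θ
      = ∫ x, pd j (pd k (pd l (fun t => F t x))) θ ∂μ

/-- The consolidated Lehmann and Basu et al. regularity conditions when the true density is
`h = f_{θ₀}`, a member of the model. -/
structure LehmannBasuConditions (Θ : Set (E p)) (μ : Measure 𝒳) (f : E p → 𝒳 → ℝ) (β : ℝ)
    (θ₀ : E p) : Prop where
  /-- The support `{x | f_θ(x) > 0}` does not depend on `θ`. -/
  common_support : ∀ θ ∈ Θ, {x | 0 < f θ x} = {x | 0 < f θ₀ x}
  /-- There is a neighbourhood `s` of `θ₀` on which the remaining smoothness conditions hold. -/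
  smooth : ∃ s : Set (E p), IsOpen s ∧ s ⊆ Θ ∧ θ₀ ∈ s ∧
    (∀ᵐ x ∂μ, 0 < f θ₀ x → ContDiffOn ℝ 3 (fun θ => f θ x) s) ∧
    ThriceDiffUnderIntegral μ (fun θ x => f θ x ^ (1 + β)) s ∧
    ThriceDiffUnderIntegral μ (fun θ x => f θ x ^ β * f θ₀ x) s ∧
    ∃ M : Fin p → Fin p → Fin p → 𝒳 → ℝ,
      (∀ᵐ x ∂μ, 0 < f θ₀ x → ∀ θ ∈ s, ∀ j k l,
        |pd j (pd k (pd l (fun t => V μ f β t x))) θ| ≤ M j k l x) ∧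
      ∀ j k l, Integrable (M j k l) (modelMeasure μ f θ₀)
  posDef : (J μ f β θ₀).PosDef

end Model

section Constraint

variable {p r : ℕ}

/-- The `p × r` matrix `G(θ) = ∂gᵀ(θ)/∂θ`. -/
def G (g : E p → E r) (θ : E p) : Matrix (Fin p) (Fin r) ℝ :=
  Matrix.of fun i j => pd i (fun t => g t j) θ

/-- The restricted parameter space `Θ₀ = {θ ∈ Θ | g(θ) = 0}`. -/
def restricted (Θ : Set (E p)) (g : E p → E r) : Set (E p) := {θ | θ ∈ Θ ∧ g θ = 0}

variable {𝒳 : Type*} [MeasurableSpace 𝒳]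

/-- `Q = J⁻¹ G (Gᵀ J⁻¹ G)⁻¹`. -/
def Q (μ : Measure 𝒳) (f : E p → 𝒳 → ℝ) (β : ℝ) (g : E p → E r) (θ : E p) :
    Matrix (Fin p) (Fin r) ℝ :=
  (J μ f β θ)⁻¹ * G g θ * ((G g θ).transpose * (J μ f β θ)⁻¹ * G g θ)⁻¹

/-- `P = J⁻¹ - Q Gᵀ J⁻¹`. -/
def P (μ : Measure 𝒳) (f : E p → 𝒳 → ℝ) (β : ℝ) (g : E p → E r) (θ : E p) :
    Matrix (Fin p) (Fin p) ℝ :=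
  (J μ f β θ)⁻¹ - Q μ f β g θ * (G g θ).transpose * (J μ f β θ)⁻¹

/-- `Σ = P K P`. -/
def asymptoticCov (μ : Measure 𝒳) (f : E p → 𝒳 → ℝ) (β : ℝ) (g : E p → E r) (θ : E p) :
    Matrix (Fin p) (Fin p) ℝ :=
  P μ f β g θ * K μ f β θ * P μ f β g θ

/-- `√n (θ̃ₙ - θ₀)` converges in law to the centred normal distribution with covariance matrix
`S`. -/
def AsymptoticallyNormal {Ω : Type*} [MeasurableSpace Ω] (Pr : Measure Ω)
    [IsProbabilityMeasure Pr] (est : ℕ → Ω → E p) (θ₀ : E p) (S : Matrix (Fin p) (Fin p) ℝ) :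
    Prop :=
  TendstoInDistribution (fun (n : ℕ) w => √(n : ℝ) • (est n w - θ₀)) atTop
    (id : E p → E p) (fun _ => Pr) (multivariateGaussian 0 S)

end Constraint

end DPD

end

/-!
Write `v = V_θ`. At `θ₀` its gradient `z` is `(1 + β)(ξ - u f^β)`, which has mean zero and
covariance `(1 + β)² K`, and its Hessian has mean `(1 + β) J`. The bound on the third derivatives
turns the empirical criterion into a quadratic function near `θ₀`, with an error that is uniform
over a fixed ball. Since `J` is positive definite, minimizers in a small ball are consistent.

At a consistent restricted minimizer `θ` the gradient of the empirical criterion annihilates the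
kernel of `g'(θ)`. With `A = g'(θ₀) = Gᵀ`, `d = θ - θ₀` and `zₙ` the empirical mean of `z`, this
condition and `g(θ) = 0` read, up to terms of smaller order, `zₙ + (1 + β) J d ∈ (ker A)ᗮ` and
`A d = 0`. The block `(1 + β)⁻¹ P` of the inverse of the bordered matrix `[[(1 + β) J, Aᵀ], [A, 0]]`
solves them, so `d = -(1 + β)⁻¹ P zₙ` up to smaller order. The central limit theorem for `zₙ` yields
the covariance matrix `P K P`.
-/

noncomputable section

open Metric Gradient InnerProductSpace
open scoped RealInnerProductSpace

namespace DPD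

section HighProbability

variable {Ω : Type*} [MeasurableSpace Ω] {Pr : Measure Ω} {A B : ℕ → Ω → Prop}

lemma WithHighProbability.mono (hA : WithHighProbability Pr A) (h : ∀ n w, A n w → B n w) :
    WithHighProbability Pr B :=
  tendsto_of_tendsto_of_tendsto_of_le_of_le tendsto_const_nhds hA (fun _ => zero_le)
    fun n => measure_mono fun w hw hB => hw (h n w hB)

lemma WithHighProbability.and (hA : WithHighProbability Pr A) (hB : WithHighProbability Pr B) :
    WithHighProbability Pr fun n w => A n w ∧ B n w := by
  have hsum : Tendsto (fun n => Pr {w | ¬ A n w} + Pr {w | ¬ B n w}) atTop (𝓝 0) := by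
    simpa using Tendsto.add hA hB
  refine tendsto_of_tendsto_of_tendsto_of_le_of_le tendsto_const_nhds hsum (fun _ => zero_le)
    fun n => (measure_mono fun w hw => ?_).trans (measure_union_le _ _)
  exact not_and_or.1 hw

lemma WithHighProbability.of_ae (h : ∀ n, ∀ᵐ w ∂Pr, A n w) : WithHighProbability Pr A := by
  simp [WithHighProbability, fun n => ae_iff.1 (h n)]

lemma tendstoInMeasure_const_iff {F : Type*} [SeminormedAddCommGroup F] {Y : ℕ → Ω → F} {y : F} :
    TendstoInMeasure Pr Y atTop (fun _ => y) ↔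
      ∀ δ > 0, WithHighProbability Pr fun n w => ‖Y n w - y‖ < δ := by
  simp only [tendstoInMeasure_iff_norm, WithHighProbability, not_lt, gt_iff_lt]

lemma withHighProbability_of_eventually_nhds {F : Type*} [SeminormedAddCommGroup F]
    {Y : ℕ → Ω → F} {y : F} (hY : TendstoInMeasure Pr Y atTop fun _ => y) {q : F → Prop}
    (hq : ∀ᶠ t in 𝓝 y, q t) : WithHighProbability Pr fun n w => q (Y n w) := by
  obtain ⟨δ, hδ, hball⟩ := Metric.eventually_nhds_iff_ball.1 hq
  exact (tendstoInMeasure_const_iff.1 hY δ hδ).mono fun n w hw => hball _ (mem_ball_iff_norm.2 hw)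

end HighProbability

section CentralLimit

variable {Ω Ω' 𝒳 : Type*} [MeasurableSpace Ω] [MeasurableSpace Ω'] [MeasurableSpace 𝒳]
  {Pr : Measure Ω} {Pr' : Measure Ω'} {ν : Measure 𝒳}

/-- `X₀, X₁, …` are independent and identically distributed with law `ν`. -/
structure IsIIDSample (Pr : Measure Ω) (X : ℕ → Ω → 𝒳) (ν : Measure 𝒳) : Prop where
  iIndepFun : iIndepFun X Pr
  hasLaw : ∀ i, HasLaw (X i) ν Pr

lemma IsIIDSample.comp {X : ℕ → Ω → 𝒳} (hX : IsIIDSample Pr X ν) {F : Type*} [MeasurableSpace F]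
    {φ : 𝒳 → F} (hφ : AEMeasurable φ ν) : IsIIDSample Pr (fun i => φ ∘ X i) (ν.map φ) where
  iIndepFun := hX.iIndepFun.comp₀ (fun _ => φ) (fun i => (hX.hasLaw i).aemeasurable)
    fun i => (hX.hasLaw i).map_eq ▸ hφ
  hasLaw i := HasLaw.comp ⟨hφ, rfl⟩ (hX.hasLaw i)

lemma IsIIDSample.identDistrib {X : ℕ → Ω → 𝒳} (hX : IsIIDSample Pr X ν) (i j : ℕ) :
    IdentDistrib (X i) (X j) Pr Pr :=
  ⟨(hX.hasLaw i).aemeasurable, (hX.hasLaw j).aemeasurable,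
    (hX.hasLaw i).map_eq.trans (hX.hasLaw j).map_eq.symm⟩

/-- The average `(1/n) ∑ φ(Xᵢ)` over the first `n` observations, with value `0` at `n = 0`. -/
def sampleMean {F : Type*} [AddCommGroup F] [Module ℝ F] (X : ℕ → Ω → 𝒳) (φ : 𝒳 → F) (n : ℕ)
    (w : Ω) : F :=
  (n : ℝ)⁻¹ • ∑ i ∈ Finset.range n, φ (X i w)

lemma IsIIDSample.aemeasurable_sampleMean {X : ℕ → Ω → 𝒳} (hX : IsIIDSample Pr X ν) {F : Type*}
    [AddCommGroup F] [Module ℝ F] [MeasurableSpace F] [MeasurableAdd₂ F] [MeasurableConstSMul ℝ F]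
    {φ : 𝒳 → F} (hφ : AEMeasurable φ ν) (n : ℕ) : AEMeasurable (sampleMean X φ n) Pr :=
  (Finset.aemeasurable_fun_sum _ fun i _ => ((hX.comp hφ).hasLaw i).aemeasurable).const_smul _

lemma IsIIDSample.tendstoInMeasure_sampleMean [IsProbabilityMeasure Pr] {X : ℕ → Ω → 𝒳}
    (hX : IsIIDSample Pr X ν) {F : Type*} [NormedAddCommGroup F] [NormedSpace ℝ F]
    [CompleteSpace F] [MeasurableSpace F] [BorelSpace F] {φ : 𝒳 → F} (hφ : Integrable φ ν) :
    TendstoInMeasure Pr (sampleMean X φ) atTop fun _ => ∫ x, φ x ∂ν := by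
  have h_int : ∀ i, Integrable (φ ∘ X i) Pr := fun i =>
    Integrable.comp_aemeasurable (by rwa [(hX.hasLaw i).map_eq]) (hX.hasLaw i).aemeasurable
  have hφX := hX.comp hφ.aestronglyMeasurable.aemeasurable
  have hlim := strong_law_ae (fun i => φ ∘ X i) (h_int 0)
    (fun i j hij => hφX.iIndepFun.indepFun hij) fun i => hφX.identDistrib i 0
  rw [(hX.hasLaw 0).integral_comp hφ.aestronglyMeasurable] at hlim
  exact tendstoInMeasure_of_tendsto_ae (fun n => (Finset.aestronglyMeasurable_fun_sum _
    fun i _ => (h_int i).aestronglyMeasurable).const_smul _) hlim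

lemma charFun_map_inner {F : Type*} [NormedAddCommGroup F] [InnerProductSpace ℝ F]
    [MeasurableSpace F] [BorelSpace F] {Y : Ω → F} (hY : AEMeasurable Y Pr) (t : F) :
    charFun (Pr.map fun w => ⟪t, Y w⟫) 1 = charFun (Pr.map Y) t := by
  have ht : AEMeasurable (fun w => ⟪t, Y w⟫) Pr :=
    (innerSL ℝ t).continuous.measurable.comp_aemeasurable hY
  rw [charFun_apply, charFun_apply, integral_map ht (by fun_prop),
    integral_map hY (by fun_prop)]
  simp [real_inner_comm]

lemma tendstoInDistribution_of_inner [IsProbabilityMeasure Pr] [IsProbabilityMeasure Pr']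
    {F : Type*} [NormedAddCommGroup F] [InnerProductSpace ℝ F] [FiniteDimensional ℝ F]
    [MeasurableSpace F] [BorelSpace F] {Y : ℕ → Ω → F} {Z : Ω' → F}
    (hY : ∀ n, AEMeasurable (Y n) Pr) (hZ : AEMeasurable Z Pr')
    (h : ∀ t : F, TendstoInDistribution (fun n w => ⟪t, Y n w⟫) atTop (fun w => ⟪t, Z w⟫)
      (fun _ => Pr) Pr') :
    TendstoInDistribution Y atTop Z (fun _ => Pr) Pr' := by
  refine ⟨hY, hZ, ProbabilityMeasure.tendsto_iff_tendsto_charFun.2 fun t => ?_⟩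
  simpa only [ProbabilityMeasure.coe_mk, charFun_map_inner hZ, charFun_map_inner (hY _)] using
    ProbabilityMeasure.tendsto_iff_tendsto_charFun.1 (h t).tendsto 1

lemma hasLaw_inner_multivariateGaussian {ι : Type*} [Fintype ι] [DecidableEq ι]
    {S : Matrix ι ι ℝ} (hS : S.PosSemidef) (t : EuclideanSpace ℝ ι) :
    HasLaw (fun x => ⟪t, x⟫) (gaussianReal 0 (t.ofLp ⬝ᵥ S.mulVec t.ofLp).toNNReal)
      (multivariateGaussian 0 S) where
  map_eq := by
    change Measure.map (innerSL ℝ t) _ = _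
    rw [IsGaussian.map_eq_gaussianReal, ContinuousLinearMap.integral_comp_id_comm
      IsGaussian.integrable_id, integral_id_multivariateGaussian, map_zero,
      ← covarianceBilin_multivariateGaussian hS, covarianceBilin_self IsGaussian.memLp_two_id]
    rfl

variable {ι : Type*} [Fintype ι]

lemma dotProduct_mulVec_eq_integral_inner_sq {φ : 𝒳 → EuclideanSpace ℝ ι} (hφ : MemLp φ 2 ν)
    {S : Matrix ι ι ℝ} (hS : ∀ i j, ∫ x, φ x i * φ x j ∂ν = S i j) (t : EuclideanSpace ℝ ι) :
    t.ofLp ⬝ᵥ S.mulVec t.ofLp = ∫ x, ⟪t, φ x⟫ ^ 2 ∂ν := by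
  have h_int : ∀ i j, Integrable (fun x => t i * t j * (φ x i * φ x j)) ν := fun i j =>
    ((hφ.eval_piLp i).integrable_mul (hφ.eval_piLp j)).const_mul _
  have hexpand : ∀ x, ⟪t, φ x⟫ ^ 2 = ∑ i, ∑ j, t i * t j * (φ x i * φ x j) := fun x => by
    simp only [PiLp.inner_apply, RCLike.inner_apply, conj_trivial, sq, Finset.sum_mul_sum]
    exact Finset.sum_congr rfl fun i _ => Finset.sum_congr rfl fun j _ => by ring
  simp_rw [hexpand]
  rw [integral_finsetSum _ fun i _ => integrable_finsetSum _ fun j _ => h_int i j]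
  simp_rw [integral_finsetSum _ fun j (_ : j ∈ Finset.univ) => h_int _ j, integral_const_mul, hS,
    dotProduct, Matrix.mulVec, dotProduct, Finset.mul_sum]
  exact Finset.sum_congr rfl fun i _ => Finset.sum_congr rfl fun j _ => by ring

lemma posSemidef_of_second_moments {φ : 𝒳 → EuclideanSpace ℝ ι} (hφ : MemLp φ 2 ν)
    {S : Matrix ι ι ℝ} (hS : ∀ i j, ∫ x, φ x i * φ x j ∂ν = S i j) : S.PosSemidef := by
  refine Matrix.PosSemidef.of_dotProduct_mulVec_nonneg ?_ fun t => ?_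
  · ext i j
    simp only [Matrix.conjTranspose_apply, star_trivial, ← hS, mul_comm]
  · rw [star_trivial, dotProduct_mulVec_eq_integral_inner_sq hφ hS (WithLp.toLp 2 t)]
    exact integral_nonneg fun x => sq_nonneg _

lemma IsIIDSample.tendstoInDistribution_gaussianReal [IsProbabilityMeasure Pr] {X : ℕ → Ω → 𝒳}
    (hX : IsIIDSample Pr X ν) {φ : 𝒳 → ℝ} (hφ : MemLp φ 2 ν) (hmean : ∫ x, φ x ∂ν = 0)
    {Z : Ω' → ℝ} [IsProbabilityMeasure Pr']
    (hZ : HasLaw Z (gaussianReal 0 (∫ x, φ x ^ 2 ∂ν).toNNReal) Pr') :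
    TendstoInDistribution (fun (n : ℕ) w => √(n : ℝ) • sampleMean X φ n w) atTop Z (fun _ => Pr)
      Pr' := by
  have hm : AEMeasurable φ ν := hφ.aestronglyMeasurable.aemeasurable
  have hmem : MemLp (φ ∘ X 0) 2 Pr :=
    MemLp.comp_of_map (by rwa [(hX.hasLaw 0).map_eq]) (hX.hasLaw 0).aemeasurable
  have hmean' : ∫ w, (φ ∘ X 0) w ∂Pr = 0 :=
    ((hX.hasLaw 0).integral_comp hφ.aestronglyMeasurable).trans hmean
  have hvar : Var[φ ∘ X 0; Pr] = ∫ x, φ x ^ 2 ∂ν := by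
    rw [variance_eq_integral hmem.aestronglyMeasurable.aemeasurable, hmean',
      ← (hX.hasLaw 0).integral_comp (by fun_prop)]
    simp
  have hclt := tendstoInDistribution_inv_sqrt_mul_sum_sub (hvar ▸ hZ) hmem (hX.comp hm).iIndepFun
    fun i => (hX.comp hm).identDistrib i 0
  rw [hmean'] at hclt
  refine hclt.congr (fun n => ae_of_all _ fun w => ?_) Filter.EventuallyEq.rfl
  simp only [sampleMean, smul_eq_mul, mul_zero, sub_zero, Function.comp_apply, ← mul_assoc,
    ← div_eq_mul_inv, Real.sqrt_div_self]

lemma IsIIDSample.tendstoInDistribution_multivariateGaussian [DecidableEq ι]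
    [IsProbabilityMeasure Pr] {X : ℕ → Ω → 𝒳} (hX : IsIIDSample Pr X ν)
    {φ : 𝒳 → EuclideanSpace ℝ ι} (hφ : MemLp φ 2 ν) (hmean : ∫ x, φ x ∂ν = 0)
    {S : Matrix ι ι ℝ} (hS : ∀ i j, ∫ x, φ x i * φ x j ∂ν = S i j) :
    TendstoInDistribution (fun (n : ℕ) w => √(n : ℝ) • sampleMean X φ n w) atTop id (fun _ => Pr)
      (multivariateGaussian 0 S) := by
  have hν : IsProbabilityMeasure ν := (hX.hasLaw 0).isProbabilityMeasure_iff.1 ‹_›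
  have hm : AEMeasurable φ ν := hφ.aestronglyMeasurable.aemeasurable
  refine tendstoInDistribution_of_inner
    (fun n => (hX.aemeasurable_sampleMean hm n).const_smul (√(n : ℝ))) aemeasurable_id fun t => ?_
  have h_int : Integrable φ ν := hφ.integrable (by norm_num)
  have hmean_t : ∫ x, ⟪t, φ x⟫ ∂ν = 0 := by rw [integral_inner h_int, hmean, inner_zero_right]
  have hlaw := hasLaw_inner_multivariateGaussian (posSemidef_of_second_moments hφ hS) t
  rw [dotProduct_mulVec_eq_integral_inner_sq hφ hS] at hlaw
  refine (hX.tendstoInDistribution_gaussianReal (hφ.const_inner t) hmean_t hlaw).congr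
    (fun n => ae_of_all _ fun w => ?_) Filter.EventuallyEq.rfl
  simp [sampleMean, inner_smul_right, inner_sum]

lemma exists_forall_measure_lt_norm_le [IsProbabilityMeasure Pr] [IsProbabilityMeasure Pr']
    {F : Type*} [NormedAddCommGroup F] [InnerProductSpace ℝ F] [FiniteDimensional ℝ F]
    [MeasurableSpace F] [BorelSpace F] {W : ℕ → Ω → F} {Z : Ω' → F}
    (h : TendstoInDistribution W atTop Z (fun _ => Pr) Pr') {ε : ENNReal} (hε : 0 < ε) :
    ∃ a : ℝ, ∀ n, Pr {w | a < ‖W n w‖} ≤ ε := by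
  have hprob : ∀ n, IsProbabilityMeasure (Pr.map (W n)) := fun n =>
    Measure.isProbabilityMeasure_map (h.forall_aemeasurable n)
  have : IsProbabilityMeasure (Pr'.map Z) :=
    Measure.isProbabilityMeasure_map h.aemeasurable_limit
  have htight := isTightMeasureSet_of_tendsto_charFun (μ := fun n => Pr.map (W n))
    (f := charFun (Pr'.map Z)) continuous_charFun.continuousAt
    (ProbabilityMeasure.tendsto_iff_tendsto_charFun.1 h.tendsto)
  obtain ⟨a, ha⟩ :=
    ((tendsto_measure_norm_gt_of_isTightMeasureSet htight).eventually_le_const hε).exists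
  refine ⟨a, fun n => ?_⟩
  have hn : Pr.map (W n) {x | a < ‖x‖} ≤ ε :=
    (le_iSup₂ (f := fun (μ : Measure F) (_ : μ ∈ Set.range fun n => Pr.map (W n)) =>
      μ {x | a < ‖x‖}) (Pr.map (W n)) ⟨n, rfl⟩).trans ha
  rwa [Measure.map_apply_of_aemeasurable (h.forall_aemeasurable n)
    (measurableSet_lt measurable_const measurable_norm)] at hn

lemma tendstoInMeasure_zero_of_norm_le_mul [IsProbabilityMeasure Pr] [IsProbabilityMeasure Pr']
    {F F' : Type*} [NormedAddCommGroup F] [InnerProductSpace ℝ F] [FiniteDimensional ℝ F]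
    [MeasurableSpace F] [BorelSpace F] [SeminormedAddCommGroup F'] {W : ℕ → Ω → F} {Z : Ω' → F}
    {Y : ℕ → Ω → F'} (h : TendstoInDistribution W atTop Z (fun _ => Pr) Pr')
    (hY : ∀ ε > 0, WithHighProbability Pr fun n w => ‖Y n w‖ ≤ ε * ‖W n w‖) :
    TendstoInMeasure Pr Y atTop fun _ => 0 := by
  refine tendstoInMeasure_iff_norm.2 fun δ hδ => ENNReal.tendsto_nhds_zero.2 fun ε hε => ?_
  obtain ⟨a, ha⟩ := exists_forall_measure_lt_norm_le h (ENNReal.half_pos hε.ne')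
  set c := max a 1
  have hc : 0 < c := lt_max_of_lt_right one_pos
  filter_upwards [ENNReal.tendsto_nhds_zero.1 (hY (δ / (2 * c)) (by positivity)) (ε / 2)
    (ENNReal.half_pos hε.ne')] with n hn
  calc Pr {w | δ ≤ ‖Y n w - 0‖}
      ≤ Pr ({w | ¬ ‖Y n w‖ ≤ δ / (2 * c) * ‖W n w‖} ∪ {w | a < ‖W n w‖}) := by
        refine measure_mono fun w hw => ?_
        by_contra! hcon
        simp only [Set.mem_union, Set.mem_ofPred_eq, not_or, not_lt] at hcon
        have hW : ‖W n w‖ ≤ c := hcon.2.trans (le_max_left _ _)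
        have hδY : δ ≤ ‖Y n w‖ := by simpa using hw
        have : ‖Y n w‖ ≤ δ / 2 := calc
          ‖Y n w‖ ≤ δ / (2 * c) * ‖W n w‖ := hcon.1
          _ ≤ δ / (2 * c) * c := by gcongr
          _ = δ / 2 := by field_simp
        linarith
    _ ≤ ε / 2 + ε / 2 := (measure_union_le _ _).trans (add_le_add hn (ha n))
    _ = ε := ENNReal.add_halves ε

end CentralLimit

section QuadraticApproximation

variable {F : Type*} [NormedAddCommGroup F] [InnerProductSpace ℝ F]
  {v : F → ℝ} {θ₀ θ z : F} {ρ b : ℝ} {H : F →L[ℝ] F}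

lemma add_smul_sub_mem_ball (hθ : θ ∈ ball θ₀ ρ) {t : ℝ} (ht : t ∈ Set.Icc (0 : ℝ) 1) :
    θ₀ + t • (θ - θ₀) ∈ ball θ₀ ρ := by
  rw [mem_ball_iff_norm, add_sub_cancel_left, norm_smul, Real.norm_of_nonneg ht.1]
  exact (mul_le_of_le_one_left (norm_nonneg _) ht.2).trans_lt (mem_ball_iff_norm.1 hθ)

variable [CompleteSpace F]

lemma gradient_fun_sum {ι : Type*} {s : Finset ι} {v : ι → F → ℝ}
    (h : ∀ i ∈ s, DifferentiableAt ℝ (v i) θ) :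
    ∇ (fun t => ∑ i ∈ s, v i t) θ = ∑ i ∈ s, ∇ (v i) θ := by
  simp only [gradient, fderiv_fun_sum h, map_sum]

lemma gradient_fun_const_mul (h : DifferentiableAt ℝ v θ) (c : ℝ) :
    ∇ (fun t => c * v t) θ = c • ∇ v θ := by
  simp [gradient, fderiv_const_mul h]

lemma hasDerivAt_sub_quadratic_along_line {d : F} {t : ℝ}
    (hv : DifferentiableAt ℝ v (θ₀ + t • d)) (z : F) (H : F →L[ℝ] F) :
    HasDerivAt (fun t : ℝ => v (θ₀ + t • d) - t * ⟪z, d⟫ - t ^ 2 / 2 * ⟪H d, d⟫)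
      ⟪∇ v (θ₀ + t • d) - z - H (t • d), d⟫ t := by
  have hline : HasDerivAt (fun t : ℝ => θ₀ + t • d) d t := by
    simpa using ((hasDerivAt_id t).smul_const d).const_add θ₀
  have hlin : HasDerivAt (fun t : ℝ => t * ⟪z, d⟫) ⟪z, d⟫ t := by
    simpa using (hasDerivAt_id t).mul_const ⟪z, d⟫
  have hquad : HasDerivAt (fun t : ℝ => t ^ 2 / 2 * ⟪H d, d⟫) (t * ⟪H d, d⟫) t := by
    convert! (((hasDerivAt_id t).pow 2).div_const 2).mul_const ⟪H d, d⟫ using 1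
    simp
  convert! ((hv.hasFDerivAt.comp_hasDerivAt t hline).sub hlin).sub hquad using 1
  rw [inner_sub_left, inner_sub_left, map_smul, real_inner_smul_left, inner_gradient_left]

lemma abs_sub_quadratic_le {m : ℕ} (hv : DifferentiableOn ℝ v (ball θ₀ ρ))
    (h : ∀ θ ∈ ball θ₀ ρ, ‖∇ v θ - z - H (θ - θ₀)‖ ≤ b * ‖θ - θ₀‖ ^ m) (hθ : θ ∈ ball θ₀ ρ) :
    |v θ - v θ₀ - ⟪z, θ - θ₀⟫ - 1 / 2 * ⟪H (θ - θ₀), θ - θ₀⟫| ≤ b * ‖θ - θ₀‖ ^ (m + 1) := by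
  rcases eq_or_ne θ θ₀ with rfl | hne
  · simp
  set d := θ - θ₀ with hd
  have hb : 0 ≤ b := nonneg_of_mul_nonneg_left ((norm_nonneg _).trans (h θ hθ))
    (pow_pos (norm_pos_iff.2 (sub_ne_zero.2 hne)) m)
  have hderiv : ∀ t ∈ Set.Icc (0 : ℝ) 1, HasDerivWithinAt
      (fun t : ℝ => v (θ₀ + t • d) - t * ⟪z, d⟫ - t ^ 2 / 2 * ⟪H d, d⟫)
      ⟪∇ v (θ₀ + t • d) - z - H (t • d), d⟫ (Set.Icc 0 1) t := fun t ht =>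
    (hasDerivAt_sub_quadratic_along_line (hv.differentiableAt
      (isOpen_ball.mem_nhds (add_smul_sub_mem_ball hθ ht))) z H).hasDerivWithinAt
  have hbound : ∀ t ∈ Set.Ico (0 : ℝ) 1,
      ‖⟪∇ v (θ₀ + t • d) - z - H (t • d), d⟫‖ ≤ b * ‖d‖ ^ (m + 1) := fun t ht => by
    have htd : ‖t • d‖ ≤ ‖d‖ := by
      rw [norm_smul, Real.norm_of_nonneg ht.1]
      exact mul_le_of_le_one_left (norm_nonneg _) ht.2.le
    have hgrad := h _ (add_smul_sub_mem_ball hθ ⟨ht.1, ht.2.le⟩)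
    rw [add_sub_cancel_left] at hgrad
    calc ‖⟪∇ v (θ₀ + t • d) - z - H (t • d), d⟫‖
        ≤ ‖∇ v (θ₀ + t • d) - z - H (t • d)‖ * ‖d‖ := norm_inner_le_norm _ _
      _ ≤ b * ‖d‖ ^ m * ‖d‖ := by gcongr; exact hgrad.trans (by gcongr)
      _ = b * ‖d‖ ^ (m + 1) := by ring
  refine le_trans (le_of_eq ?_) (norm_image_sub_le_of_norm_deriv_le_segment_01' hderiv hbound)
  rw [Real.norm_eq_abs]
  congr 1
  simp [hd]
  ring

/-- On the ball of radius `ρ` around `θ₀` the function `v` is continuously differentiable, and its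
gradient is that of the quadratic polynomial with gradient `z` and Hessian `H` at `θ₀`, up to an
error of size `b ‖θ - θ₀‖²`. -/
structure QuadApprox (v : F → ℝ) (θ₀ : F) (ρ : ℝ) (z : F) (H : F →L[ℝ] F) (b : ℝ) : Prop where
  contDiffOn : ContDiffOn ℝ 1 v (ball θ₀ ρ)
  norm_gradient_sub_le : ∀ θ ∈ ball θ₀ ρ, ‖∇ v θ - z - H (θ - θ₀)‖ ≤ b * ‖θ - θ₀‖ ^ 2

namespace QuadApprox

lemma contDiffAt (h : QuadApprox v θ₀ ρ z H b) (hθ : θ ∈ ball θ₀ ρ) : ContDiffAt ℝ 1 v θ :=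
  h.contDiffOn.contDiffAt (isOpen_ball.mem_nhds hθ)

lemma differentiableAt (h : QuadApprox v θ₀ ρ z H b) (hθ : θ ∈ ball θ₀ ρ) :
    DifferentiableAt ℝ v θ :=
  (h.contDiffAt hθ).differentiableAt one_ne_zero

lemma sum {ι : Type*} {s : Finset ι} {v : ι → F → ℝ} {z : ι → F} {H : ι → F →L[ℝ] F} {b : ι → ℝ}
    (h : ∀ i ∈ s, QuadApprox (v i) θ₀ ρ (z i) (H i) (b i)) :
    QuadApprox (fun t => ∑ i ∈ s, v i t) θ₀ ρ (∑ i ∈ s, z i) (∑ i ∈ s, H i) (∑ i ∈ s, b i) where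
  contDiffOn := ContDiffOn.sum fun i hi => (h i hi).contDiffOn
  norm_gradient_sub_le θ hθ := by
    rw [gradient_fun_sum fun i hi => (h i hi).differentiableAt hθ, _root_.sum_apply,
      ← Finset.sum_sub_distrib, ← Finset.sum_sub_distrib, Finset.sum_mul]
    exact norm_sum_le_of_le _ fun i hi => (h i hi).norm_gradient_sub_le θ hθ

lemma const_mul (h : QuadApprox v θ₀ ρ z H b) {c : ℝ} (hc : 0 ≤ c) :
    QuadApprox (fun t => c * v t) θ₀ ρ (c • z) (c • H) (c • b) where
  contDiffOn := contDiffOn_const.mul h.contDiffOn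
  norm_gradient_sub_le θ hθ := by
    rw [gradient_fun_const_mul (h.differentiableAt hθ), _root_.smul_apply, ← smul_sub,
      ← smul_sub, norm_smul, Real.norm_of_nonneg hc, smul_eq_mul, mul_assoc]
    exact mul_le_mul_of_nonneg_left (h.norm_gradient_sub_le θ hθ) hc

lemma norm_gradient_sub_le_mul (h : QuadApprox v θ₀ ρ z H b) {J : F →L[ℝ] F} {δ : ℝ}
    (hHJ : ‖H - J‖ ≤ δ / 2) (hθ : θ ∈ ball θ₀ ρ) (hb : b * ‖θ - θ₀‖ ≤ δ / 2) :
    ‖∇ v θ - z - J (θ - θ₀)‖ ≤ δ * ‖θ - θ₀‖ := calc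
  ‖∇ v θ - z - J (θ - θ₀)‖ = ‖(∇ v θ - z - H (θ - θ₀)) + (H - J) (θ - θ₀)‖ := by
        rw [_root_.sub_apply]; abel_nf
  _ ≤ b * ‖θ - θ₀‖ * ‖θ - θ₀‖ + δ / 2 * ‖θ - θ₀‖ := by
        refine norm_add_le_of_le ?_ ((H - J).le_of_opNorm_le hHJ _)
        exact (h.norm_gradient_sub_le θ hθ).trans_eq (by ring)
  _ ≤ δ / 2 * ‖θ - θ₀‖ + δ / 2 * ‖θ - θ₀‖ := by gcongr
  _ = δ * ‖θ - θ₀‖ := by ring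

lemma mul_norm_sub_le (h : QuadApprox v θ₀ ρ z H b) {J : F →L[ℝ] F} {c : ℝ}
    (hJ : ∀ d, 4 * c * ‖d‖ ^ 2 ≤ ⟪J d, d⟫) (hHJ : ‖H - J‖ ≤ c) (hθ : θ ∈ ball θ₀ ρ)
    (hb : b * ‖θ - θ₀‖ ≤ c / 2) (hle : v θ ≤ v θ₀) : c * ‖θ - θ₀‖ ≤ ‖z‖ := by
  have hval := abs_sub_quadratic_le
    (fun θ hθ => (h.differentiableAt hθ).differentiableWithinAt) h.norm_gradient_sub_le hθ
  set d := θ - θ₀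
  rcases (norm_nonneg d).eq_or_lt with hd | hd
  · simp [← hd]
  have hz : -(‖z‖ * ‖d‖) ≤ ⟪z, d⟫ := neg_le_of_abs_le (abs_real_inner_le_norm z d)
  have hdiff : -(c * ‖d‖ * ‖d‖) ≤ ⟪(H - J) d, d⟫ :=
    neg_le_of_abs_le ((abs_real_inner_le_norm _ d).trans
      (mul_le_mul_of_nonneg_right ((H - J).le_of_opNorm_le hHJ d) hd.le))
  rw [_root_.sub_apply, inner_sub_left] at hdiff
  have hcube : b * ‖d‖ ^ 3 ≤ c / 2 * ‖d‖ ^ 2 := by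
    nlinarith [mul_le_mul_of_nonneg_right hb (sq_nonneg ‖d‖)]
  refine le_of_mul_le_mul_right (a := ‖d‖) ?_ hd
  nlinarith [(abs_le.1 hval).1, hJ d]

end QuadApprox

variable {p : ℕ} {v : E p → ℝ} {θ₀ : E p}

lemma gradient_apply (v : E p → ℝ) (θ : E p) (j : Fin p) : ∇ v θ j = pd j v θ := by
  rw [pd, ← inner_gradient_left, EuclideanSpace.inner_single_right]
  simp

lemma norm_le_sum_abs (w : E p) : ‖w‖ ≤ ∑ j, |w j| := calc
  ‖w‖ = ‖∑ j, w j • EuclideanSpace.single j (1 : ℝ)‖ := by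
        congr 1; ext i; simp [Pi.single_apply]
  _ ≤ ∑ j, |w j| := norm_sum_le_of_le _ fun j _ => by simp [norm_smul]

/-- The matrix of second partial derivatives. -/
def hessian (v : E p → ℝ) (θ : E p) : Matrix (Fin p) (Fin p) ℝ :=
  Matrix.of fun l k => pd k (pd l v) θ

lemma toEuclideanCLM_hessian_apply (v : E p → ℝ) (θ w : E p) (l : Fin p) :
    Matrix.toEuclideanCLM (𝕜 := ℝ) (hessian v θ) w l = ⟪∇ (pd l v) θ, w⟫ := by
  rw [PiLp.inner_apply]
  simp [hessian, gradient_apply, Matrix.mulVec, dotProduct, mul_comm]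

lemma contDiffOn_one_of_differentiableOn_pd {s : Set (E p)} (hs : IsOpen s)
    (h₀ : DifferentiableOn ℝ v s) (h₁ : ∀ l, DifferentiableOn ℝ (pd l v) s) :
    ContDiffOn ℝ 1 v s := by
  rw [← zero_add 1, contDiffOn_succ_iff_fderiv_of_isOpen hs]
  refine ⟨h₀, by simp, contDiffOn_zero.2 ?_⟩
  have hsum : fderiv ℝ v = fun θ => ∑ j, pd j v θ • (EuclideanSpace.proj j : E p →L[ℝ] ℝ) := by
    ext θ w
    simp [← inner_gradient_left, PiLp.inner_apply, gradient_apply, mul_comm]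
  rw [hsum]
  exact continuousOn_finsetSum _ fun j _ => (h₁ j).continuousOn.smul continuousOn_const

lemma quadApprox_of_abs_pd_pd_pd_le (h₀ : DifferentiableOn ℝ v (ball θ₀ ρ))
    (h₁ : ∀ l, DifferentiableOn ℝ (pd l v) (ball θ₀ ρ))
    (h₂ : ∀ k l, DifferentiableOn ℝ (pd k (pd l v)) (ball θ₀ ρ)) {B : Fin p → Fin p → Fin p → ℝ}
    (h₃ : ∀ θ ∈ ball θ₀ ρ, ∀ j k l, |pd j (pd k (pd l v)) θ| ≤ B j k l) :
    QuadApprox v θ₀ ρ (∇ v θ₀) (Matrix.toEuclideanCLM (𝕜 := ℝ) (hessian v θ₀))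
      (∑ l, ∑ k, ∑ j, B j k l) := by
  have hsecond : ∀ k l, ∀ θ ∈ ball θ₀ ρ,
      |pd k (pd l v) θ - pd k (pd l v) θ₀| ≤ (∑ j, B j k l) * ‖θ - θ₀‖ := fun k l θ hθ => by
    have hgrad : ∀ t ∈ ball θ₀ ρ, ‖∇ (pd k (pd l v)) t‖ ≤ ∑ j, B j k l := fun t ht =>
      (norm_le_sum_abs _).trans (Finset.sum_le_sum fun j _ => by
        simpa only [gradient_apply] using h₃ t ht j k l)
    simpa using abs_sub_quadratic_le (h₂ k l) (z := 0) (H := 0) (m := 0) (by simpa using hgrad) hθ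
  have hfirst : ∀ l, ∀ θ ∈ ball θ₀ ρ,
      |pd l v θ - pd l v θ₀ - ⟪∇ (pd l v) θ₀, θ - θ₀⟫| ≤ (∑ k, ∑ j, B j k l) * ‖θ - θ₀‖ ^ 2 :=
    fun l θ hθ => by
    have hgrad : ∀ t ∈ ball θ₀ ρ,
        ‖∇ (pd l v) t - ∇ (pd l v) θ₀‖ ≤ (∑ k, ∑ j, B j k l) * ‖t - θ₀‖ := fun t ht => by
      rw [Finset.sum_mul]
      exact (norm_le_sum_abs _).trans (Finset.sum_le_sum fun k _ => by
        simpa only [PiLp.sub_apply, gradient_apply] using hsecond k l t ht)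
    simpa using abs_sub_quadratic_le (h₁ l) (z := ∇ (pd l v) θ₀) (H := 0) (m := 1)
      (by simpa using hgrad) hθ
  refine ⟨contDiffOn_one_of_differentiableOn_pd isOpen_ball h₀ h₁, fun θ hθ => ?_⟩
  rw [Finset.sum_mul]
  exact (norm_le_sum_abs _).trans (Finset.sum_le_sum fun l _ => by
    simpa only [PiLp.sub_apply, gradient_apply, toEuclideanCLM_hessian_apply] using hfirst l θ hθ)

end QuadraticApproximation

section LagrangeSystem

lemma norm_add_le_of_norm_add_le_mul {V : Type*} [SeminormedAddCommGroup V] {d w z : V}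
    {η a : ℝ} (hη₀ : 0 ≤ η) (hη : η ≤ 1 / 2) (hw : ‖w‖ ≤ a * ‖z‖) (h : ‖d + w‖ ≤ η * (‖d‖ + ‖z‖)) :
    ‖d + w‖ ≤ 2 * η * (a + 1) * ‖z‖ := by
  have hd : ‖d‖ ≤ ‖d + w‖ + a * ‖z‖ := calc
    ‖d‖ = ‖d + w - w‖ := by rw [add_sub_cancel_right]
    _ ≤ ‖d + w‖ + a * ‖z‖ := norm_sub_le_of_le le_rfl hw
  nlinarith [mul_le_mul_of_nonneg_left hd hη₀, mul_nonneg (sub_nonneg.2 hη) (norm_nonneg (d + w))]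

lemma eventually_nhdsGT_mul_le (c : ℝ) {ε : ℝ} (hε : 0 < ε) :
    ∀ᶠ δ in 𝓝[>] (0 : ℝ), δ * c ≤ ε := by
  have h : Tendsto (· * c) (𝓝 0) (𝓝 0) := (continuous_mul_const c).tendsto' 0 0 (zero_mul c)
  exact (h.mono_left nhdsWithin_le_nhds).eventually_le_const hε

variable {U W : Type*} [NormedAddCommGroup U] [InnerProductSpace ℝ U]
  [NormedAddCommGroup W] [NormedSpace ℝ W]

/-- `P` and `R` form the first row of the inverse of the bordered operator `[[J, Aᵀ], [A, 0]]` of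
the Lagrange system with Hessian `J` and linear constraint `A`; the omitted second row gives the
Lagrange multipliers. -/
structure IsBorderedInverse (A : U →L[ℝ] W) (J P : U →L[ℝ] U) (R : W →L[ℝ] U) : Prop where
  isSymmetric : (P : U →ₗ[ℝ] U).IsSymmetric
  apply_apply : ∀ x, P (J x) = x - R (A x)
  rightInverse : ∀ y, A (R y) = y
  constraint_apply : ∀ x, A (P x) = 0

namespace IsBorderedInverse

variable {A A' : U →L[ℝ] W} {J P : U →L[ℝ] U} {R R' : W →L[ℝ] U} {d z γ : U} {δ : ℝ}

lemma smul (h : IsBorderedInverse A J P R) {c : ℝ} (hc : c ≠ 0) :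
    IsBorderedInverse A (c • J) (c⁻¹ • P) R where
  isSymmetric := h.isSymmetric.smul (by simp)
  apply_apply x := by simp [smul_smul, hc, h.apply_apply]
  rightInverse := h.rightInverse
  constraint_apply x := by simp [h.constraint_apply]

lemma norm_apply_le_of_orthogonal_ker (h : IsBorderedInverse A J P R)
    (hR' : ∀ y, A' (R' y) = y) (hγ : ∀ x, A' x = 0 → ⟪γ, x⟫ = 0) :
    ‖P γ‖ ≤ ‖R'‖ * ‖A' - A‖ * ‖P‖ * ‖γ‖ := by
  have hsub : (A' - A) (P (P γ)) = A' (P (P γ)) := by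
    rw [_root_.sub_apply, h.constraint_apply, sub_zero]
  have hinner : ⟪γ, P (P γ)⟫ = ⟪γ, R' ((A' - A) (P (P γ)))⟫ := by
    rw [hsub, ← sub_eq_zero, ← inner_sub_right]
    exact hγ _ (by rw [map_sub, hR', sub_self])
  have hsq : ‖P γ‖ * ‖P γ‖ ≤ ‖R'‖ * ‖A' - A‖ * ‖P‖ * ‖γ‖ * ‖P γ‖ := calc
    ‖P γ‖ * ‖P γ‖ = ⟪γ, P (P γ)⟫ := by
      rw [← real_inner_self_eq_norm_mul_norm]; exact h.isSymmetric γ (P γ)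
    _ ≤ ‖γ‖ * ‖R' ((A' - A) (P (P γ)))‖ := hinner ▸ real_inner_le_norm _ _
    _ ≤ ‖γ‖ * (‖R'‖ * (‖A' - A‖ * (‖P‖ * ‖P γ‖))) := by
      gcongr
      exact R'.le_opNorm_of_le ((A' - A).le_opNorm_of_le (P.le_opNorm _))
    _ = ‖R'‖ * ‖A' - A‖ * ‖P‖ * ‖γ‖ * ‖P γ‖ := by ring
  rcases (norm_nonneg (P γ)).eq_or_lt with h0 | h0
  · rw [← h0]; positivity
  · exact le_of_mul_le_mul_right hsq h0

lemma norm_add_apply_le (h : IsBorderedInverse A J P R) (hδ₁ : δ ≤ 1)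
    (hR' : ∀ y, A' (R' y) = y) (hγ : ‖γ - z - J d‖ ≤ δ * ‖d‖) (hA' : ‖A' - A‖ ≤ δ)
    (hAd : ‖A d‖ ≤ δ * ‖d‖) (hker : ∀ x, A' x = 0 → ⟪γ, x⟫ = 0) :
    ‖d + P z‖ ≤ δ * (‖R'‖ * ‖P‖ * (‖J‖ + 1) + ‖R‖ + ‖P‖) * (‖d‖ + ‖z‖) := by
  have hδ : 0 ≤ δ := (norm_nonneg _).trans hA'
  have hγ_le : ‖γ‖ ≤ (‖J‖ + 1) * (‖d‖ + ‖z‖) := calc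
    ‖γ‖ = ‖(γ - z - J d) + z + J d‖ := by congr 1; abel
    _ ≤ 1 * ‖d‖ + ‖z‖ + ‖J‖ * ‖d‖ :=
        norm_add_le_of_le (norm_add_le_of_le (hγ.trans (by gcongr)) le_rfl) (J.le_opNorm d)
    _ ≤ (‖J‖ + 1) * (‖d‖ + ‖z‖) := by
        nlinarith [mul_nonneg (norm_nonneg J) (norm_nonneg z)]
  have hPγ : ‖P γ‖ ≤ ‖R'‖ * δ * ‖P‖ * ((‖J‖ + 1) * (‖d‖ + ‖z‖)) :=
    (h.norm_apply_le_of_orthogonal_ker hR' hker).trans (by gcongr)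
  calc ‖d + P z‖ = ‖P γ + R (A d) - P (γ - z - J d)‖ := by
        congr 1; simp only [map_sub, h.apply_apply]; abel
    _ ≤ ‖R'‖ * δ * ‖P‖ * ((‖J‖ + 1) * (‖d‖ + ‖z‖)) + ‖R‖ * (δ * ‖d‖) + ‖P‖ * (δ * ‖d‖) :=
        norm_sub_le_of_le (norm_add_le_of_le hPγ (R.le_opNorm_of_le hAd)) (P.le_opNorm_of_le hγ)
    _ ≤ ‖R'‖ * δ * ‖P‖ * ((‖J‖ + 1) * (‖d‖ + ‖z‖)) + ‖R‖ * (δ * (‖d‖ + ‖z‖))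
          + ‖P‖ * (δ * (‖d‖ + ‖z‖)) := by
        gcongr <;> exact le_add_of_nonneg_right (norm_nonneg z)
    _ = δ * (‖R'‖ * ‖P‖ * (‖J‖ + 1) + ‖R‖ + ‖P‖) * (‖d‖ + ‖z‖) := by ring

end IsBorderedInverse

lemma exists_rightInverse_of_norm_sub_mul_le [CompleteSpace W] {A A' : U →L[ℝ] W} {R : W →L[ℝ] U}
    (hR : ∀ y, A (R y) = y) (hA' : ‖A' - A‖ * ‖R‖ ≤ 1 / 2) :
    ∃ R' : W →L[ℝ] U, (∀ y, A' (R' y) = y) ∧ ‖R'‖ ≤ 2 * ‖R‖ := by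
  set T : W →L[ℝ] W := (A - A').comp R with hT_def
  have hT : ‖T‖ ≤ 1 / 2 := ((A - A').opNorm_comp_le R).trans (norm_sub_rev A A' ▸ hA')
  have hT₁ : ‖T‖ < 1 := hT.trans_lt (by norm_num)
  have hinv : ‖∑' n : ℕ, T ^ n‖ ≤ 2 := calc
    ‖∑' n : ℕ, T ^ n‖ ≤ ‖(1 : W →L[ℝ] W)‖ - 1 + (1 - ‖T‖)⁻¹ :=
        tsum_geometric_le_of_norm_lt_one T hT₁
    _ ≤ 1 - 1 + (1 - 1 / 2)⁻¹ := by gcongr; exact ContinuousLinearMap.norm_id_le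
    _ = 2 := by norm_num
  have hA'R : A'.comp R = 1 - T := by
    ext y
    simp [hT_def, hR]
  refine ⟨R.comp (∑' n : ℕ, T ^ n), fun y => ?_, ?_⟩
  · exact congrArg (fun S : W →L[ℝ] W => S y)
      (show (A'.comp R) * ∑' n : ℕ, T ^ n = 1 from hA'R ▸ mul_neg_geom_series T hT₁)
  · calc ‖R.comp (∑' n : ℕ, T ^ n)‖ ≤ ‖R‖ * 2 := (R.opNorm_comp_le _).trans (by gcongr)
      _ = 2 * ‖R‖ := mul_comm _ _

lemma IsBorderedInverse.eventually_norm_add_apply_le [CompleteSpace W] {A : U →L[ℝ] W}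
    {J P : U →L[ℝ] U} {R : W →L[ℝ] U} (h : IsBorderedInverse A J P R) {ε : ℝ} (hε : 0 < ε) :
    ∀ᶠ δ in 𝓝[>] (0 : ℝ), ∀ (d z γ : U) (A' : U →L[ℝ] W), ‖γ - z - J d‖ ≤ δ * ‖d‖ →
      ‖A' - A‖ ≤ δ → ‖A d‖ ≤ δ * ‖d‖ → (Function.Surjective A' → ∀ x, A' x = 0 → ⟪γ, x⟫ = 0) →
      ‖d + P z‖ ≤ ε * ‖z‖ := by
  set C := 2 * ‖R‖ * ‖P‖ * (‖J‖ + 1) + ‖R‖ + ‖P‖ with hC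
  filter_upwards [self_mem_nhdsWithin, eventually_nhdsGT_mul_le 1 one_pos,
    eventually_nhdsGT_mul_le ‖R‖ one_half_pos, eventually_nhdsGT_mul_le C one_half_pos,
    eventually_nhdsGT_mul_le (2 * C * (‖P‖ + 1)) hε]
    with δ (hδ : 0 < δ) hδ₁ hδR hδC hδε d z γ A' hγ hA' hAd hker
  obtain ⟨R', hR', hR'R⟩ := exists_rightInverse_of_norm_sub_mul_le h.rightInverse
    ((mul_le_mul_of_nonneg_right hA' (norm_nonneg R)).trans hδR)
  have hle : ‖d + P z‖ ≤ δ * C * (‖d‖ + ‖z‖) :=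
    (h.norm_add_apply_le (by linarith) hR' hγ hA' hAd (hker fun y => ⟨R' y, hR' y⟩)).trans
      (by rw [hC]; gcongr)
  calc ‖d + P z‖ ≤ 2 * (δ * C) * (‖P‖ + 1) * ‖z‖ :=
        norm_add_le_of_norm_add_le_mul (by positivity) hδC (P.le_opNorm z) hle
    _ = δ * (2 * C * (‖P‖ + 1)) * ‖z‖ := by ring
    _ ≤ ε * ‖z‖ := by gcongr

lemma inner_gradient_eq_zero_of_isLocalMinOn [CompleteSpace U] [CompleteSpace W] {φ : U → ℝ}
    {g : U → W} {g' : U →L[ℝ] W} {Θ : Set U} {θ : U} (hφ : ContDiffAt ℝ 1 φ θ)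
    (hg : HasStrictFDerivAt g g' θ) (hg' : Function.Surjective g') (hΘ : Θ ∈ 𝓝 θ) (hθ : g θ = 0)
    (hmin : IsLocalMinOn φ {t | t ∈ Θ ∧ g t = 0} θ) {x : U} (hx : g' x = 0) :
    ⟪∇ φ θ, x⟫ = 0 := by
  have hmin' : IsLocalExtrOn φ {t | g t = g θ} θ := by
    refine Or.inl (hmin.filter_mono ?_)
    rw [hθ, ← nhdsWithin_inter_of_mem (mem_nhdsWithin_of_mem_nhds hΘ)]
    exact nhdsWithin_mono _ fun t ht => ht
  obtain ⟨Λ, Λ₀, hne, hΛ⟩ := hmin'.exists_linear_map_of_hasStrictFDerivAt hg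
    (hφ.hasStrictFDerivAt one_ne_zero)
  have hΛ₀ : Λ₀ ≠ 0 := by
    rintro rfl
    refine hne (Prod.ext (LinearMap.ext fun y => ?_) rfl)
    obtain ⟨x, rfl⟩ := hg' y
    simpa using hΛ x
  rw [inner_gradient_left]
  simpa [hx, hΛ₀] using hΛ x

end LagrangeSystem

section MEstimation

variable {𝒳 F W : Type*} [NormedAddCommGroup F] [InnerProductSpace ℝ F] [NormedAddCommGroup W]
  [NormedSpace ℝ W]

lemma eventually_constraint_linearization {g : F → W} {θ₀ : F} (hg : ContDiffAt ℝ 1 g θ₀)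
    (hθ₀ : g θ₀ = 0) {δ : ℝ} (hδ : 0 < δ) :
    ∀ᶠ θ in 𝓝 θ₀, ContDiffAt ℝ 1 g θ ∧ ‖fderiv ℝ g θ - fderiv ℝ g θ₀‖ ≤ δ ∧
      (g θ = 0 → ‖fderiv ℝ g θ₀ (θ - θ₀)‖ ≤ δ * ‖θ - θ₀‖) := by
  have hcont : ContinuousAt (fderiv ℝ g) θ₀ :=
    (hg.fderiv_right (m := 0) (by norm_num)).continuousAt
  filter_upwards [hg.eventually (by simp), Metric.tendsto_nhds.1 hcont δ hδ,
    ((hg.differentiableAt one_ne_zero).hasFDerivAt.isLittleO).def hδ] with θ hgθ hA hlin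
  refine ⟨hgθ, by simpa only [dist_eq_norm] using hA.le, fun hθ => ?_⟩
  rwa [hθ, hθ₀, sub_zero, zero_sub, norm_neg] at hlin

variable [CompleteSpace F]

lemma quadApprox_sampleMean {Ω : Type*} {X : ℕ → Ω → 𝒳} {v : 𝒳 → F → ℝ} {θ₀ : F} {ρ : ℝ}
    {z : 𝒳 → F} {H : 𝒳 → F →L[ℝ] F} {b : 𝒳 → ℝ} {w : Ω}
    (h : ∀ i, QuadApprox (v (X i w)) θ₀ ρ (z (X i w)) (H (X i w)) (b (X i w))) (n : ℕ) :
    QuadApprox (sampleMean X v n w) θ₀ ρ (sampleMean X z n w) (sampleMean X H n w)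
      (sampleMean X b n w) := by
  convert! (QuadApprox.sum (s := Finset.range n) fun i _ => h i).const_mul
    (c := (n : ℝ)⁻¹) (by positivity) using 1
  ext θ
  simp [sampleMean]

variable [MeasurableSpace 𝒳]

/-- The criterion `v` under the law `ν`: near `θ₀` it has integrable quadratic approximations, its
gradient `z` at `θ₀` is centred and square integrable, and its mean Hessian at `θ₀` is `J`. -/
structure RegularCriterion (ν : Measure 𝒳) (v : 𝒳 → F → ℝ) (θ₀ : F) (ρ : ℝ) (z : 𝒳 → F)
    (H : 𝒳 → F →L[ℝ] F) (b : 𝒳 → ℝ) (J : F →L[ℝ] F) : Prop where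
  pos : 0 < ρ
  quadApprox : ∀ᵐ x ∂ν, QuadApprox (v x) θ₀ ρ (z x) (H x) (b x)
  memLp : MemLp z 2 ν
  integral_gradient : ∫ x, z x ∂ν = 0
  integrable_hessian : Integrable H ν
  integral_hessian : ∫ x, H x ∂ν = J
  integrable_bound : Integrable b ν

variable {Ω : Type*} [MeasurableSpace Ω] {Pr : Measure Ω} [IsProbabilityMeasure Pr]
  {ν : Measure 𝒳} {X : ℕ → Ω → 𝒳}

section Consistency

variable {v : 𝒳 → F → ℝ} {θ₀ : F} {ρ : ℝ} {z : 𝒳 → F} {H : 𝒳 → F →L[ℝ] F} {b : 𝒳 → ℝ}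
  {J : F →L[ℝ] F}

namespace RegularCriterion

lemma tendstoInMeasure_sampleMean_gradient (h : RegularCriterion ν v θ₀ ρ z H b J)
    (hX : IsIIDSample Pr X ν) : TendstoInMeasure Pr (sampleMean X z) atTop fun _ => 0 := by
  have hν : IsProbabilityMeasure ν := (hX.hasLaw 0).isProbabilityMeasure_iff.1 ‹_›
  borelize F
  simpa only [h.integral_gradient] using
    hX.tendstoInMeasure_sampleMean (h.memLp.integrable one_le_two)

lemma exists_quadApprox_sampleMean (h : RegularCriterion ν v θ₀ ρ z H b J) (hX : IsIIDSample Pr X ν)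
    {δ : ℝ} (hδ : 0 < δ) :
    WithHighProbability Pr fun n w => ∃ (H' : F →L[ℝ] F) (b' : ℝ),
      QuadApprox (sampleMean X v n w) θ₀ ρ (sampleMean X z n w) H' b' ∧ ‖H' - J‖ ≤ δ ∧
        b' ≤ |∫ x, b x ∂ν| + 1 := by
  borelize (F →L[ℝ] F)
  have happrox : ∀ᵐ w ∂Pr, ∀ i,
      QuadApprox (v (X i w)) θ₀ ρ (z (X i w)) (H (X i w)) (b (X i w)) :=
    ae_all_iff.2 fun i => ae_of_ae_map (hX.hasLaw i).aemeasurable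
      (by rw [(hX.hasLaw i).map_eq]; exact h.quadApprox)
  have hH : TendstoInMeasure Pr (sampleMean X H) atTop fun _ => J := by
    simpa only [h.integral_hessian] using hX.tendstoInMeasure_sampleMean h.integrable_hessian
  have hb := hX.tendstoInMeasure_sampleMean h.integrable_bound
  refine ((WithHighProbability.of_ae fun _ => happrox).and
    ((tendstoInMeasure_const_iff.1 hH δ hδ).and
      (tendstoInMeasure_const_iff.1 hb 1 one_pos))).mono ?_
  rintro n w ⟨hw, hHw, hbw⟩
  refine ⟨sampleMean X H n w, sampleMean X b n w, DPD.quadApprox_sampleMean hw n, hHw.le, ?_⟩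
  linarith [(abs_lt.1 (Real.norm_eq_abs _ ▸ hbw)).2, le_abs_self (∫ x, b x ∂ν)]

lemma exists_tendstoInMeasure_of_le (h : RegularCriterion ν v θ₀ ρ z H b J)
    (hX : IsIIDSample Pr X ν) {m : ℝ} (hm : 0 < m) (hJ : ∀ d, m * ‖d‖ ^ 2 ≤ ⟪J d, d⟫) :
    ∃ ρ₀ ∈ Set.Ioo 0 ρ, ∀ est : ℕ → Ω → F,
      WithHighProbability Pr (fun n w => est n w ∈ closedBall θ₀ ρ₀ ∧
        sampleMean X v n w (est n w) ≤ sampleMean X v n w θ₀) →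
      TendstoInMeasure Pr est atTop fun _ => θ₀ := by
  set B := |∫ x, b x ∂ν| + 1
  have : 0 < B := by positivity
  obtain ⟨c, rfl⟩ : ∃ c, 4 * c = m := ⟨m / 4, by ring⟩
  have hc : 0 < c := by linarith
  obtain ⟨ρ₀, hρ₀, hlt⟩ := exists_between (lt_min h.pos (show 0 < c / (2 * B) by positivity))
  rw [lt_min_iff, lt_div_iff₀ (by positivity)] at hlt
  refine ⟨ρ₀, ⟨hρ₀, hlt.1⟩, fun est hest => tendstoInMeasure_const_iff.2 fun δ hδ => ?_⟩
  have hz := tendstoInMeasure_const_iff.1 (h.tendstoInMeasure_sampleMean_gradient hX) (c * δ)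
    (by positivity)
  refine (((h.exists_quadApprox_sampleMean hX hc).and hz).and hest).mono ?_
  rintro n w ⟨⟨⟨H', b', happrox, hH', hb'⟩, hz⟩, hmem, hle⟩
  rw [mem_closedBall_iff_norm] at hmem
  have hb : b' * ‖est n w - θ₀‖ ≤ c / 2 := calc
    b' * ‖est n w - θ₀‖ ≤ B * ρ₀ := by gcongr
    _ ≤ c / 2 := by linarith
  have hgrowth := happrox.mul_norm_sub_le hJ hH' (mem_ball_iff_norm.2 (hmem.trans_lt hlt.1)) hb hle
  rw [sub_zero] at hz
  exact lt_of_mul_lt_mul_left (hgrowth.trans_lt hz) hc.le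

end RegularCriterion

end Consistency

variable [CompleteSpace W] {g : F → W} {Θ : Set F} {θ₀ : F} {v : 𝒳 → F → ℝ} {ρ : ℝ}
  {z : 𝒳 → F} {H : 𝒳 → F →L[ℝ] F} {b : 𝒳 → ℝ} {J P : F →L[ℝ] F} {R : W →L[ℝ] F} {est : ℕ → Ω → F}

lemma RegularCriterion.norm_sub_add_apply_le (h : RegularCriterion ν v θ₀ ρ z H b J)
    (hX : IsIIDSample Pr X ν) (hΘ : Θ ∈ 𝓝 θ₀) (hg : ContDiffAt ℝ 1 g θ₀) (hθ₀ : g θ₀ = 0)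
    (hP : IsBorderedInverse (fderiv ℝ g θ₀) J P R)
    (hest : WithHighProbability Pr fun n w => est n w ∈ {θ | θ ∈ Θ ∧ g θ = 0} ∧
      IsLocalMinOn (sampleMean X v n w) {θ | θ ∈ Θ ∧ g θ = 0} (est n w))
    (hcons : TendstoInMeasure Pr est atTop fun _ => θ₀) {ε : ℝ} (hε : 0 < ε) :
    WithHighProbability Pr fun n w =>
      ‖est n w - θ₀ + P (sampleMean X z n w)‖ ≤ ε * ‖sampleMean X z n w‖ := by
  obtain ⟨δ, hstable, hδ : 0 < δ⟩ :=
    ((hP.eventually_norm_add_apply_le hε).and self_mem_nhdsWithin).exists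
  set B := |∫ x, b x ∂ν| + 1
  have : 0 < B := by positivity
  have hradius : ∀ᶠ θ in 𝓝 θ₀, θ ∈ ball θ₀ ρ ∧ θ ∈ ball θ₀ (δ / 2 / B) :=
    Filter.Eventually.and (ball_mem_nhds θ₀ h.pos) (ball_mem_nhds θ₀ (by positivity))
  have hnear := withHighProbability_of_eventually_nhds hcons
    ((eventually_mem_nhds_iff.2 hΘ).and
      ((eventually_constraint_linearization hg hθ₀ hδ).and hradius))
  refine (((h.exists_quadApprox_sampleMean hX (half_pos hδ)).and hnear).and hest).mono ?_
  rintro n w ⟨⟨⟨H', b', happrox, hH', hb'⟩, hΘw, ⟨hgw, hA, hconstraint⟩, hball, hsmall⟩, hmem, hmin⟩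
  rw [mem_ball_iff_norm, lt_div_iff₀' (by positivity)] at hsmall
  have hb : b' * ‖est n w - θ₀‖ ≤ δ / 2 :=
    (mul_le_mul_of_nonneg_right hb' (norm_nonneg _)).trans hsmall.le
  exact hstable _ _ _ _ (happrox.norm_gradient_sub_le_mul hH' hball hb) hA (hconstraint hmem.2)
    fun hsurj x hx => inner_gradient_eq_zero_of_isLocalMinOn (happrox.contDiffAt hball)
      (hgw.hasStrictFDerivAt one_ne_zero) hsurj hΘw hmem.2 hmin hx

lemma RegularCriterion.asymptoticallyNormal {p : ℕ} {g : E p → W} {Θ : Set (E p)} {θ₀ : E p}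
    {v : 𝒳 → E p → ℝ} {z : 𝒳 → E p} {H : 𝒳 → E p →L[ℝ] E p} {J P : E p →L[ℝ] E p}
    {R : W →L[ℝ] E p} {est : ℕ → Ω → E p} (h : RegularCriterion ν v θ₀ ρ z H b J)
    (hX : IsIIDSample Pr X ν) (hΘ : Θ ∈ 𝓝 θ₀) (hg : ContDiffAt ℝ 1 g θ₀) (hθ₀ : g θ₀ = 0)
    (hP : IsBorderedInverse (fderiv ℝ g θ₀) J P R) {S : Matrix (Fin p) (Fin p) ℝ}
    (hS : ∀ i j, ∫ x, P (z x) i * P (z x) j ∂ν = S i j) (hmeas : ∀ n, AEMeasurable (est n) Pr)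
    (hest : WithHighProbability Pr fun n w => est n w ∈ {θ | θ ∈ Θ ∧ g θ = 0} ∧
      IsLocalMinOn (sampleMean X v n w) {θ | θ ∈ Θ ∧ g θ = 0} (est n w))
    (hcons : TendstoInMeasure Pr est atTop fun _ => θ₀) :
    AsymptoticallyNormal Pr est θ₀ S := by
  have hν : IsProbabilityMeasure ν := (hX.hasLaw 0).isProbabilityMeasure_iff.1 ‹_›
  have hclt := hX.tendstoInDistribution_multivariateGaussian (φ := fun x => -P (z x))
    (P.comp_memLp' h.memLp).neg
    (by rw [integral_neg, P.integral_comp_comm (h.memLp.integrable one_le_two),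
          h.integral_gradient, map_zero, neg_zero])
    (by simpa using hS)
  have hcltz := hX.tendstoInDistribution_multivariateGaussian h.memLp h.integral_gradient
    (S := Matrix.of fun i j => ∫ x, z x i * z x j ∂ν) fun i j => rfl
  refine tendstoInDistribution_of_tendstoInMeasure_sub _ _ hclt ?_
    fun n => ((hmeas n).sub_const θ₀).const_smul (√(n : ℝ))
  refine tendstoInMeasure_zero_of_norm_le_mul hcltz fun ε hε =>
    (h.norm_sub_add_apply_le hX hΘ hg hθ₀ hP hest hcons hε).mono fun n w hw => ?_
  have hsample : sampleMean X (fun x => -P (z x)) n w = -P (sampleMean X z n w) := by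
    simp [sampleMean]
  change ‖√(n : ℝ) • (est n w - θ₀) - √(n : ℝ) • sampleMean X (fun x => -P (z x)) n w‖ ≤ _
  rw [hsample, ← smul_sub, sub_neg_eq_add, norm_smul, norm_smul, mul_left_comm]
  gcongr

end MEstimation

section MeasurableSelection

variable {𝒴 S : Type*} [MeasurableSpace 𝒴] [TopologicalSpace S] {F : 𝒴 → S → ℝ} {q : S → ℝ}
  {C : Set S}

/-- A Carathéodory function on `𝒴 × C`: measurable in the first variable and continuous on `C` in
the second. -/
structure IsCaratheodoryOn (F : 𝒴 → S → ℝ) (C : Set S) : Prop where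
  measurable : ∀ θ ∈ C, Measurable fun y => F y θ
  continuousOn : ∀ y, ContinuousOn (F y) C

namespace IsCaratheodoryOn

lemma sub_measurable (hF : IsCaratheodoryOn F C) {m : 𝒴 → ℝ} (hm : Measurable m) :
    IsCaratheodoryOn (fun y θ => F y θ - m y) C where
  measurable θ hθ := (hF.measurable θ hθ).sub hm
  continuousOn y := (hF.continuousOn y).sub continuousOn_const

lemma max_sub_measurable (hF : IsCaratheodoryOn F C) (hq : ContinuousOn q C) {m : 𝒴 → ℝ}
    (hm : Measurable m) : IsCaratheodoryOn (fun y θ => max (F y θ) (q θ - m y)) C where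
  measurable θ hθ := (hF.measurable θ hθ).max (measurable_const.sub hm)
  continuousOn y := (hF.continuousOn y).sup (hq.sub continuousOn_const)

variable [SecondCountableTopology S]

lemma measurableSet_exists_lt (hF : IsCaratheodoryOn F C) (c : ℝ) :
    MeasurableSet {y | ∃ θ ∈ C, F y θ < c} := by
  obtain ⟨D, hD, hdense⟩ := TopologicalSpace.exists_countable_dense C
  have hset : {y | ∃ θ ∈ C, F y θ < c} = ⋃ d ∈ D, {y | F y (d : C) < c} := by
    ext y
    simp only [Set.mem_ofPred_eq, Set.mem_iUnion, exists_prop]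
    refine ⟨fun ⟨θ, hθ, hlt⟩ => ?_, fun ⟨d, _, hlt⟩ => ⟨d, d.2, hlt⟩⟩
    obtain ⟨d, hd, hdD⟩ := hdense.inter_open_nonempty _
      (isOpen_Iio.preimage (hF.continuousOn y).domRestrict) ⟨⟨θ, hθ⟩, hlt⟩
    exact ⟨d, hdD, hd⟩
  rw [hset]
  exact MeasurableSet.biUnion hD fun d _ => measurableSet_lt (hF.measurable d d.2) measurable_const

lemma measurable_sInf_image (hF : IsCaratheodoryOn F C) (hC : IsCompact C) (hne : C.Nonempty) :
    Measurable fun y => sInf (F y '' C) := by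
  refine measurable_of_Iio fun c => ?_
  convert! hF.measurableSet_exists_lt c using 1
  ext y
  simp [csInf_lt_iff (hC.image_of_continuousOn (hF.continuousOn y)).bddBelow (hne.image _)]

lemma measurableSet_exists_le (hF : IsCaratheodoryOn F C) (hC : IsCompact C) (c : ℝ) :
    MeasurableSet {y | ∃ θ ∈ C, F y θ ≤ c} := by
  rcases C.eq_empty_or_nonempty with rfl | hne
  · simp
  convert! measurableSet_le (hF.measurable_sInf_image hC hne) (measurable_const (a := c)) using 1
  ext y
  obtain ⟨θ₁, hθ₁, hmin⟩ := hC.exists_sInf_image_eq hne (hF.continuousOn y)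
  have hbdd := (hC.image_of_continuousOn (hF.continuousOn y)).bddBelow
  exact ⟨fun ⟨θ, hθ, hle⟩ => (csInf_le hbdd ⟨θ, hθ, rfl⟩).trans hle,
    fun hle => ⟨θ₁, hθ₁, hmin ▸ hle⟩⟩

lemma exists_measurable_isLeast (hF : IsCaratheodoryOn F C) (hC : IsCompact C)
    (hne : ∀ y, ∃ θ ∈ C, F y θ ≤ 0) (hq : ContinuousOn q C) :
    ∃ m : 𝒴 → ℝ, Measurable m ∧ ∀ y, IsLeast (q '' {θ ∈ C | F y θ ≤ 0}) (m y) := by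
  have hcompact : ∀ y, IsCompact {θ ∈ C | F y θ ≤ 0} := fun y => by
    obtain ⟨u, hu, heq⟩ := continuousOn_iff_isClosed.1 (hF.continuousOn y) _ isClosed_Iic
    have hset : {θ ∈ C | F y θ ≤ 0} = u ∩ C := (Set.inter_comm C _).trans heq
    exact hset ▸ hC.inter_left hu
  choose m hm using fun y => ((hcompact y).image_of_continuousOn (hq.mono fun θ hθ => hθ.1)
    ).exists_isLeast (Set.Nonempty.image q (hne y))
  refine ⟨m, measurable_of_Iic fun c => ?_, hm⟩
  convert! (hF.max_sub_measurable hq (measurable_const (a := c))).measurableSet_exists_le hC 0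
    using 1
  ext y
  constructor
  · obtain ⟨θ, ⟨hθ, hFθ⟩, hqθ⟩ := (hm y).1
    exact fun hmc => ⟨θ, hθ, max_le hFθ (sub_nonpos.2 (hqθ.trans_le hmc))⟩
  · rintro ⟨θ, hθ, hmax⟩
    obtain ⟨hFθ, hqθ⟩ := max_le_iff.1 hmax
    exact ((hm y).2 ⟨θ, ⟨hθ, hFθ⟩, rfl⟩).trans (sub_nonpos.1 hqθ)

lemma exists_measurable_level (hC : IsCompact C) {k : ℕ} {q : Fin k → S → ℝ}
    (hq : ∀ i, ContinuousOn (q i) C) (hF : IsCaratheodoryOn F C)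
    (hne : ∀ y, ∃ θ ∈ C, F y θ ≤ 0) :
    ∃ t : 𝒴 → Fin k → ℝ, Measurable t ∧
      ∀ y, ∃ θ ∈ C, F y θ ≤ 0 ∧ (fun i => q i θ) = t y := by
  induction k generalizing F with
  | zero =>
    refine ⟨fun _ => Fin.elim0, measurable_const, fun y => ?_⟩
    obtain ⟨θ, hθ, hFθ⟩ := hne y
    exact ⟨θ, hθ, hFθ, Subsingleton.elim _ _⟩
  | succ k ih =>
    obtain ⟨m, hm, hleast⟩ := hF.exists_measurable_isLeast hC hne (hq 0)
    have hne' : ∀ y, ∃ θ ∈ C, max (F y θ) (q 0 θ - m y) ≤ 0 := fun y => by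
      obtain ⟨θ, ⟨hθ, hFθ⟩, hqθ⟩ := (hleast y).1
      exact ⟨θ, hθ, by simp [hFθ, hqθ]⟩
    obtain ⟨t, ht, hsel⟩ := ih (fun i => hq i.succ) (hF.max_sub_measurable (hq 0) hm) hne'
    refine ⟨fun y => Fin.cons (m y) (t y),
      measurable_pi_iff.2 (Fin.cases hm (measurable_pi_iff.1 ht)), fun y => ?_⟩
    obtain ⟨θ, hθ, hmax, hlevel⟩ := hsel y
    obtain ⟨hFθ, hqθ⟩ := max_le_iff.1 hmax
    refine ⟨θ, hθ, hFθ, funext (Fin.cases ?_ (congrFun hlevel))⟩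
    exact le_antisymm (sub_nonpos.1 hqθ) ((hleast y).2 ⟨θ, ⟨hθ, hFθ⟩, rfl⟩)

lemma exists_measurable_isMinOn {p : ℕ} {F : 𝒴 → E p → ℝ} {C : Set (E p)}
    (hF : IsCaratheodoryOn F C) (hC : IsCompact C) (hne : C.Nonempty) :
    ∃ T : 𝒴 → E p, Measurable T ∧ ∀ y, T y ∈ C ∧ IsMinOn (F y) C (T y) := by
  have hmin : ∀ y, ∃ θ ∈ C, F y θ - sInf (F y '' C) ≤ 0 := fun y => by
    obtain ⟨θ, hθ, heq⟩ := hC.exists_sInf_image_eq hne (hF.continuousOn y)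
    exact ⟨θ, hθ, by simp [heq]⟩
  obtain ⟨t, ht, hsel⟩ := exists_measurable_level hC (q := fun (i : Fin p) (θ : E p) => θ i)
    (fun i => by fun_prop) (hF.sub_measurable (hF.measurable_sInf_image hC hne)) hmin
  refine ⟨fun y => WithLp.toLp 2 (t y), (WithLp.measurable_toLp 2 _).comp ht, fun y => ?_⟩
  obtain ⟨θ, hθ, hle, hlevel⟩ := hsel y
  obtain rfl : θ = WithLp.toLp 2 (t y) := by rw [← hlevel]
  refine ⟨hθ, fun θ' hθ' => (sub_nonpos.1 hle).trans ?_⟩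
  exact csInf_le (hC.image_of_continuousOn (hF.continuousOn y)).bddBelow ⟨θ', hθ', rfl⟩

end IsCaratheodoryOn

lemma isCaratheodoryOn_sum_indicator {v : 𝒴 → S → ℝ} {A : Set 𝒴} (hA : MeasurableSet A)
    (hv : ∀ θ ∈ C, Measurable fun x => v x θ) (hcont : ∀ x ∈ A, ContinuousOn (v x) C) (n : ℕ) :
    IsCaratheodoryOn (fun (y : Fin n → 𝒴) θ =>
      (n : ℝ)⁻¹ * ∑ i, A.indicator (fun x => v x θ) (y i)) C where
  measurable θ hθ := (Finset.measurable_fun_sum _ fun i _ =>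
    ((hv θ hθ).indicator hA).comp (measurable_pi_apply i)).const_mul _
  continuousOn y := continuousOn_const.mul <| continuousOn_finsetSum _ fun i _ => by
    by_cases hy : y i ∈ A
    · simpa [hy] using hcont _ hy
    · simpa [hy] using continuousOn_const

lemma exists_measurable_isMinOn_sampleMean {p : ℕ} {v : 𝒴 → E p → ℝ} {C : Set (E p)}
    {Ω : Type*} [MeasurableSpace Ω] {Pr : Measure Ω} {ν : Measure 𝒴} {X : ℕ → Ω → 𝒴}
    (hC : IsCompact C) (hne : C.Nonempty) (hv : ∀ θ ∈ C, Measurable fun x => v x θ)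
    (hcont : ∀ᵐ x ∂ν, ContinuousOn (v x) C) (hX : ∀ i, HasLaw (X i) ν Pr) :
    ∃ T : ∀ n : ℕ, (Fin n → 𝒴) → E p, (∀ n, Measurable (T n)) ∧
      WithHighProbability Pr fun n w => T n (fun i => X i w) ∈ C ∧
        IsMinOn (sampleMean X v n w) C (T n (fun i => X i w)) := by
  obtain ⟨A, hAν, hA, hcontA⟩ := hcont.exists_measurable_mem
  choose T hT hmin using fun n =>
    (isCaratheodoryOn_sum_indicator hA hv hcontA n).exists_measurable_isMinOn hC hne
  refine ⟨T, hT, .of_ae fun n => ?_⟩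
  have hmem : ∀ᵐ w ∂Pr, ∀ i, X i w ∈ A := ae_all_iff.2 fun i => ((hX i).ae_iff hA.mem).2 hAν
  filter_upwards [hmem] with w hw
  have hobj : sampleMean X v n w = fun θ =>
      (n : ℝ)⁻¹ * ∑ i : Fin n, A.indicator (fun x => v x θ) (X i w) := by
    funext θ
    simp [sampleMean, Finset.sum_range, hw]
  exact hobj ▸ hmin n fun i => X i w

end MeasurableSelection

section RestrictedInformation

lemma exists_pos_mul_sq_norm_le_inner {F : Type*} [NormedAddCommGroup F] [InnerProductSpace ℝ F]
    [FiniteDimensional ℝ F] {T : F →L[ℝ] F} (hT : ∀ d ≠ 0, 0 < ⟪T d, d⟫) :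
    ∃ m > 0, ∀ d, m * ‖d‖ ^ 2 ≤ ⟪T d, d⟫ := by
  have hcont : Continuous fun d => ⟪T d, d⟫ := by fun_prop
  obtain ⟨m, hm, hle⟩ := (isCompact_sphere (0 : F) 1).exists_forall_le' hcont.continuousOn
    fun d hd => hT d (ne_zero_of_mem_unit_sphere ⟨d, hd⟩)
  refine ⟨m, hm, fun d => ?_⟩
  rcases eq_or_ne d 0 with rfl | hd
  · simp
  have hd' : ‖d‖ ≠ 0 := norm_ne_zero_iff.2 hd
  calc m * ‖d‖ ^ 2 ≤ ⟪T (‖d‖⁻¹ • d), ‖d‖⁻¹ • d⟫ * ‖d‖ ^ 2 := by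
        gcongr
        exact hle _ (by simp [norm_smul, hd'])
    _ = ⟪T d, d⟫ := by
        rw [map_smul, real_inner_smul_left, real_inner_smul_right]
        field_simp

lemma mulVec_injective_of_rank_eq_card {ι κ : Type*} [Fintype κ] {B : Matrix ι κ ℝ}
    (hB : B.rank = Fintype.card κ) :
    Function.Injective B.mulVec := by
  rw [Matrix.mulVec_injective_iff, linearIndependent_iff_card_eq_finrank_span, Set.finrank,
    ← Matrix.rank_eq_finrank_span_cols, hB]

variable {ι κ : Type*} [Fintype ι] [Fintype κ] [DecidableEq ι] [DecidableEq κ]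

lemma inner_toEuclideanCLM_pos {A : Matrix ι ι ℝ} (hA : A.PosDef) {d : EuclideanSpace ℝ ι}
    (hd : d ≠ 0) : 0 < ⟪Matrix.toEuclideanCLM (𝕜 := ℝ) A d, d⟫ := by
  rw [real_inner_comm, Matrix.inner_toEuclideanCLM]
  simpa using hA.dotProduct_mulVec_pos (x := d.ofLp) (by simpa using hd)

lemma isHermitian_inv_sub {A P : Matrix ι ι ℝ} {B Q : Matrix ι κ ℝ} (hA : A.IsHermitian)
    (hQ : Q = A⁻¹ * B * (B.transpose * A⁻¹ * B)⁻¹) (hP : P = A⁻¹ - Q * B.transpose * A⁻¹) :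
    P.IsHermitian := by
  have hN := (Matrix.isHermitian_conjTranspose_mul_mul B hA.inv).inv
  have hQB := Matrix.isHermitian_mul_mul_conjTranspose (A⁻¹ * B) hN
  rw [Matrix.conjTranspose_mul, hA.inv.eq, Matrix.conjTranspose_eq_transpose_of_trivial,
    ← Matrix.mul_assoc, ← hQ] at hQB
  exact hP ▸ hA.inv.sub hQB

lemma isBorderedInverse_toEuclidean {A P : Matrix ι ι ℝ} {B Q : Matrix ι κ ℝ} (hA : A.PosDef)
    (hB : Function.Injective B.mulVec) (hQ : Q = A⁻¹ * B * (B.transpose * A⁻¹ * B)⁻¹)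
    (hP : P = A⁻¹ - Q * B.transpose * A⁻¹) :
    IsBorderedInverse (Matrix.toEuclideanLin B.transpose).toContinuousLinearMap
      (Matrix.toEuclideanCLM (𝕜 := ℝ) A) (Matrix.toEuclideanCLM (𝕜 := ℝ) P)
      (Matrix.toEuclideanLin Q).toContinuousLinearMap := by
  have hN : (B.transpose * A⁻¹ * B).PosDef := by
    simpa only [Matrix.conjTranspose_eq_transpose_of_trivial] using
      hA.inv.conjTranspose_mul_mul_same hB
  have hBQ : B.transpose * Q = 1 := by
    rw [hQ, ← Matrix.mul_assoc, ← Matrix.mul_assoc,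
      Matrix.mul_nonsing_inv _ hN.det_pos.ne'.isUnit]
  have hPA : P * A = 1 - Q * B.transpose := by
    rw [hP, Matrix.sub_mul, Matrix.mul_assoc _ A⁻¹ A,
      Matrix.nonsing_inv_mul _ hA.det_pos.ne'.isUnit, Matrix.mul_one]
  have hBP : B.transpose * P = 0 := by
    rw [hP, Matrix.mul_sub, ← Matrix.mul_assoc, ← Matrix.mul_assoc, hBQ, Matrix.one_mul, sub_self]
  refine ⟨?_, fun x => ?_, fun y => ?_, fun x => ?_⟩
  · rw [Matrix.coe_toEuclideanCLM_eq_toEuclideanLin, Matrix.isSymmetric_toEuclideanLin_iff]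
    exact isHermitian_inv_sub hA.isHermitian hQ hP
  · ext i
    simp [Matrix.mulVec_mulVec, hPA, Matrix.sub_mulVec]
  · ext i
    simp [Matrix.mulVec_mulVec, hBQ]
  · ext i
    simp [Matrix.mulVec_mulVec, hBP]

lemma integral_toEuclideanCLM_mul_toEuclideanCLM {𝒳 : Type*} [MeasurableSpace 𝒳] {ν : Measure 𝒳}
    {z : 𝒳 → EuclideanSpace ℝ ι} (hz : MemLp z 2 ν) {A S : Matrix ι ι ℝ}
    (hS : ∀ i j, ∫ x, z x i * z x j ∂ν = S i j) (i j : ι) :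
    ∫ x, Matrix.toEuclideanCLM (𝕜 := ℝ) A (z x) i * Matrix.toEuclideanCLM (𝕜 := ℝ) A (z x) j ∂ν
      = (A * S * A.transpose) i j := by
  have h_int : ∀ k l, Integrable (fun x => A i k * A j l * (z x k * z x l)) ν := fun k l =>
    ((hz.eval_piLp k).integrable_mul (hz.eval_piLp l)).const_mul _
  have hexpand : ∀ x, Matrix.toEuclideanCLM (𝕜 := ℝ) A (z x) i
      * Matrix.toEuclideanCLM (𝕜 := ℝ) A (z x) j
      = ∑ l, ∑ k, A i k * A j l * (z x k * z x l) := fun x => by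
    simp only [Matrix.ofLp_toEuclideanCLM, Matrix.mulVec, dotProduct]
    rw [Finset.sum_mul_sum, Finset.sum_comm]
    exact Finset.sum_congr rfl fun _ _ => Finset.sum_congr rfl fun _ _ => by ring
  simp_rw [hexpand]
  rw [integral_finsetSum _ fun l _ => integrable_finsetSum _ fun k _ => h_int k l]
  simp_rw [integral_finsetSum _ fun k (_ : k ∈ Finset.univ) => h_int k _, integral_const_mul, hS]
  simp only [Matrix.mul_apply, Finset.sum_mul, Matrix.transpose_apply]
  exact Finset.sum_congr rfl fun _ _ => Finset.sum_congr rfl fun _ _ => by ring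

end RestrictedInformation

section Constraint

variable {p r : ℕ} {g : E p → E r} {θ : E p} {Θ : Set (E p)}

lemma fderiv_eq_toEuclideanLin_transpose (hg : DifferentiableAt ℝ g θ) :
    fderiv ℝ g θ = (Matrix.toEuclideanLin (G g θ).transpose).toContinuousLinearMap := by
  ext x j
  have hproj : fderiv ℝ (fun t => g t j) θ = (EuclideanSpace.proj j : E r →L[ℝ] ℝ).comp
      (fderiv ℝ g θ) :=
    ((EuclideanSpace.proj j : E r →L[ℝ] ℝ).hasFDerivAt.comp θ hg.hasFDerivAt).fderiv
  have hcoord : fderiv ℝ g θ x j = ⟪∇ (fun t => g t j) θ, x⟫ := by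
    rw [inner_gradient_left, hproj]
    rfl
  rw [hcoord, PiLp.inner_apply]
  simp [gradient_apply, G, Matrix.mulVec, dotProduct, mul_comm]

lemma isCompact_restricted_inter_closedBall (hg : ContinuousOn g Θ) {ρ : ℝ}
    (hρ : closedBall θ ρ ⊆ Θ) : IsCompact (restricted Θ g ∩ closedBall θ ρ) := by
  have hset : restricted Θ g ∩ closedBall θ ρ = closedBall θ ρ ∩ g ⁻¹' {0} := by
    ext t
    exact ⟨fun h => ⟨h.2, h.1.2⟩, fun h => ⟨⟨hρ h.1, h.2⟩, h.1⟩⟩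
  rw [hset]
  exact (isCompact_closedBall θ ρ).of_isClosed_subset
    ((hg.mono hρ).preimage_isClosed_of_isClosed isClosed_closedBall isClosed_singleton)
    Set.inter_subset_left

end Constraint

section PartialDerivatives

variable {p : ℕ} {s : Set (E p)} {F F' φ : E p → ℝ} {θ : E p}

lemma eqOn_pd (hs : IsOpen s) (h : Set.EqOn F F' s) (j : Fin p) :
    Set.EqOn (pd j F) (pd j F') s := fun θ hθ => by
  rw [pd, pd, (h.eventuallyEq_of_mem (hs.mem_nhds hθ)).fderiv_eq]

lemma pd_const (c : ℝ) (j : Fin p) : pd j (fun _ => c) = fun _ => 0 := by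
  ext θ
  simp [pd]

lemma pd_sub (h : DifferentiableAt ℝ F θ) (h' : DifferentiableAt ℝ F' θ) (j : Fin p) :
    pd j (fun t => F t - F' t) θ = pd j F θ - pd j F' θ := by
  simp [pd, fderiv_fun_sub h h']

lemma pd_const_mul (h : DifferentiableAt ℝ F θ) (c : ℝ) (j : Fin p) :
    pd j (fun t => c * F t) θ = c * pd j F θ := by
  simp [pd, fderiv_const_mul h]

lemma pd_mul (h : DifferentiableAt ℝ F θ) (h' : DifferentiableAt ℝ F' θ) (j : Fin p) :
    pd j (fun t => F t * F' t) θ = F θ * pd j F' θ + pd j F θ * F' θ := by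
  simp [pd, fderiv_fun_mul h h', mul_comm]

lemma pd_eq_pd_log_mul (h : DifferentiableAt ℝ φ θ) (hne : φ θ ≠ 0) (j : Fin p) :
    pd j φ θ = pd j (fun t => Real.log (φ t)) θ * φ θ := by
  simp [pd, fderiv.log h hne, hne, mul_comm]

lemma pd_rpow_const (h : DifferentiableAt ℝ φ θ) (hpos : 0 < φ θ) (a : ℝ) (j : Fin p) :
    pd j (fun t => φ t ^ a) θ = a * (pd j (fun t => Real.log (φ t)) θ * φ θ ^ a) := by
  have hfderiv := (h.hasFDerivAt.rpow_const (p := a) (Or.inl hpos.ne')).fderiv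
  rw [pd, hfderiv, _root_.smul_apply, smul_eq_mul, ← pd, pd_eq_pd_log_mul h hpos.ne',
    Real.rpow_sub_one hpos.ne']
  field_simp

lemma contDiffOn_pd (hs : IsOpen s) {m n : WithTop ℕ∞} (h : ContDiffOn ℝ n F s)
    (hmn : m + 1 ≤ n) (j : Fin p) : ContDiffOn ℝ m (pd j F) s :=
  (h.fderiv_of_isOpen hs hmn).clm_apply contDiffOn_const

/-- `F` has partial derivatives up to order three on `s`: `F` and its partial derivatives of orders
one and two are differentiable there. -/
structure ThriceDifferentiableOn (F : E p → ℝ) (s : Set (E p)) : Prop where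
  differentiableOn : DifferentiableOn ℝ F s
  pd : ∀ l, DifferentiableOn ℝ (pd l F) s
  pd_pd : ∀ k l, DifferentiableOn ℝ (DPD.pd k (DPD.pd l F)) s

namespace ThriceDifferentiableOn

lemma of_contDiffOn (hs : IsOpen s) (h : ContDiffOn ℝ 3 F s) : ThriceDifferentiableOn F s where
  differentiableOn := h.differentiableOn (by norm_num)
  pd l := (contDiffOn_pd hs h (m := 2) (by norm_num) l).differentiableOn (by norm_num)
  pd_pd k l := (contDiffOn_pd hs (contDiffOn_pd hs h (m := 2) (by norm_num) l) (m := 1)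
    (by norm_num) k).differentiableOn (by norm_num)

lemma congr (hs : IsOpen s) (h : ThriceDifferentiableOn F s) (hF : Set.EqOn F' F s) :
    ThriceDifferentiableOn F' s where
  differentiableOn := h.differentiableOn.congr hF
  pd l := (h.pd l).congr (eqOn_pd hs hF l)
  pd_pd k l := (h.pd_pd k l).congr (eqOn_pd hs (eqOn_pd hs hF l) k)

lemma eqOn_pd_sub (hs : IsOpen s) (h : ThriceDifferentiableOn F s)
    (h' : ThriceDifferentiableOn F' s) (l : Fin p) :
    Set.EqOn (DPD.pd l fun t => F t - F' t) (fun t => DPD.pd l F t - DPD.pd l F' t) s :=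
  fun _ ht => pd_sub (h.differentiableOn.differentiableAt (hs.mem_nhds ht))
    (h'.differentiableOn.differentiableAt (hs.mem_nhds ht)) l

lemma eqOn_pd_pd_sub (hs : IsOpen s) (h : ThriceDifferentiableOn F s)
    (h' : ThriceDifferentiableOn F' s) (k l : Fin p) :
    Set.EqOn (DPD.pd k (DPD.pd l fun t => F t - F' t))
      (fun t => DPD.pd k (DPD.pd l F) t - DPD.pd k (DPD.pd l F') t) s :=
  (eqOn_pd hs (h.eqOn_pd_sub hs h' l) k).trans fun _ ht =>
    pd_sub ((h.pd l).differentiableAt (hs.mem_nhds ht))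
      ((h'.pd l).differentiableAt (hs.mem_nhds ht)) k

lemma sub (hs : IsOpen s) (h : ThriceDifferentiableOn F s) (h' : ThriceDifferentiableOn F' s) :
    ThriceDifferentiableOn (fun t => F t - F' t) s where
  differentiableOn := h.differentiableOn.sub h'.differentiableOn
  pd l := ((h.pd l).sub (h'.pd l)).congr (h.eqOn_pd_sub hs h' l)
  pd_pd k l := ((h.pd_pd k l).sub (h'.pd_pd k l)).congr (h.eqOn_pd_pd_sub hs h' k l)

end ThriceDifferentiableOn

end PartialDerivatives

section WeightedScore

variable {p : ℕ} {𝒳 : Type*} {f : E p → 𝒳 → ℝ} {β : ℝ} {s : Set (E p)} {θ : E p} {x : 𝒳}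

/-- The `i`-th component of `u_θ(x) f_θ(x)^β`, which is the estimating function of the minimum
density power divergence estimator. -/
def weightedScore (f : E p → 𝒳 → ℝ) (β : ℝ) (θ : E p) (x : 𝒳) (i : Fin p) : ℝ :=
  score f θ x i * f θ x ^ β

/-- The part of the criterion that depends on the observation, as a function of the density there
and with the opposite sign. For `β = 0` it contains the constant `1 = ∫ f_θ dμ`, so that
`V_θ(x) = ∫ f_θ^{1+β} dμ - observationTerm β (f_θ(x))` for all `β ≥ 0`. -/
def observationTerm (β y : ℝ) : ℝ :=
  if β = 0 then 1 + Real.log y else (1 + 1 / β) * y ^ β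

lemma contDiffOn_observationTerm {F : Type*} [NormedAddCommGroup F] [NormedSpace ℝ F] {s : Set F}
    {φ : F → ℝ} {n : WithTop ℕ∞} (hφ : ContDiffOn ℝ n φ s) (hpos : ∀ θ ∈ s, 0 < φ θ) :
    ContDiffOn ℝ n (fun t => observationTerm β (φ t)) s := by
  unfold observationTerm
  split_ifs
  · exact contDiffOn_const.add (hφ.log fun θ hθ => (hpos θ hθ).ne')
  · exact contDiffOn_const.mul (hφ.rpow_const_of_ne fun θ hθ => (hpos θ hθ).ne')

lemma pd_observationTerm (h : DifferentiableAt ℝ (fun t => f t x) θ) (hpos : 0 < f θ x)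
    (i : Fin p) :
    pd i (fun t => observationTerm β (f t x)) θ = (1 + β) * weightedScore f β θ x i := by
  by_cases hβ : β = 0
  · simp [observationTerm, hβ, weightedScore, score, pd, fderiv_const_add]
  · simp only [observationTerm, if_neg hβ]
    rw [pd_const_mul (h.rpow_const (Or.inl hpos.ne')), pd_rpow_const h hpos, weightedScore, score]
    field_simp
    ring

lemma weightedScore_mul_density (hβ : 0 ≤ β) (hf0 : 0 ≤ f θ x) (i : Fin p) :
    weightedScore f β θ x i * f θ x = score f θ x i * f θ x ^ (1 + β) := by
  rw [weightedScore, Real.rpow_one_add' hf0 (by positivity)]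
  ring

lemma weightedScore_mul_weightedScore_mul_density (hβ : 0 ≤ β) (hf0 : 0 ≤ f θ x)
    (i j : Fin p) : weightedScore f β θ x i * weightedScore f β θ x j * f θ x
      = score f θ x i * score f θ x j * f θ x ^ (1 + 2 * β) := by
  rw [weightedScore, weightedScore, Real.rpow_one_add' hf0 (by positivity), two_mul,
    Real.rpow_add_of_nonneg hf0 hβ hβ]
  ring

variable (hs : IsOpen s) (hf : ContDiffOn ℝ 3 (fun t => f t x) s) (hpos : ∀ t ∈ s, 0 < f t x)
  (hθ : θ ∈ s)

include hs hf hpos hθ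

lemma differentiableAt_weightedScore (i : Fin p) :
    DifferentiableAt ℝ (fun t => weightedScore f β t x i) θ := by
  have hscore : ContDiffOn ℝ 2 (fun t => score f t x i) s :=
    contDiffOn_pd hs (hf.log fun t ht => (hpos t ht).ne') (by norm_num) i
  have hpow : ContDiffOn ℝ 3 (fun t => f t x ^ β) s :=
    hf.rpow_const_of_ne fun t ht => (hpos t ht).ne'
  exact ((hscore.contDiffAt (hs.mem_nhds hθ)).differentiableAt (by norm_num)).fun_mul
    ((hpow.contDiffAt (hs.mem_nhds hθ)).differentiableAt (by norm_num))

lemma pd_pd_observationTerm (i j : Fin p) :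
    pd j (pd i fun t => observationTerm β (f t x)) θ
      = (1 + β) * pd j (fun t => weightedScore f β t x i) θ := by
  have hfirst : Set.EqOn (pd i fun t => observationTerm β (f t x))
      (fun t => (1 + β) * weightedScore f β t x i) s := fun t ht =>
    pd_observationTerm ((hf.contDiffAt (hs.mem_nhds ht)).differentiableAt (by norm_num))
      (hpos t ht) i
  rw [eqOn_pd hs hfirst j hθ, pd_const_mul (differentiableAt_weightedScore hs hf hpos hθ i)]

lemma pd_density_rpow_one_add (i : Fin p) :
    pd i (fun t => f t x ^ (1 + β)) θ = (1 + β) * (weightedScore f β θ x i * f θ x) := by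
  rw [pd_rpow_const ((hf.contDiffAt (hs.mem_nhds hθ)).differentiableAt (by norm_num)) (hpos θ hθ),
    Real.rpow_add (hpos θ hθ), Real.rpow_one, weightedScore, score]
  ring

lemma pd_pd_density_rpow_one_add (i j : Fin p) :
    pd j (pd i fun t => f t x ^ (1 + β)) θ = (1 + β) *
      ((pd j (fun t => weightedScore f β t x i) θ + score f θ x j * weightedScore f β θ x i)
        * f θ x) := by
  have hd := (hf.contDiffAt (hs.mem_nhds hθ)).differentiableAt (by norm_num)
  have hw := differentiableAt_weightedScore (β := β) hs hf hpos hθ i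
  rw [eqOn_pd hs (fun t ht => pd_density_rpow_one_add hs hf hpos ht i) j hθ,
    pd_const_mul (hw.fun_mul hd), pd_mul hw hd, pd_eq_pd_log_mul hd (hpos θ hθ).ne', ← score]
  ring

lemma pd_pd_density_rpow_mul (c : ℝ) (i j : Fin p) :
    pd j (pd i fun t => f t x ^ β * c) θ
      = β * (pd j (fun t => weightedScore f β t x i) θ * c) := by
  have hfirst : Set.EqOn (pd i fun t => f t x ^ β * c)
      (fun t => (β * c) * weightedScore f β t x i) s := fun t ht => by
    have hd := (hf.contDiffAt (hs.mem_nhds ht)).differentiableAt (by norm_num)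
    simp only [mul_comm _ c]
    rw [pd_const_mul (hd.rpow_const (Or.inl (hpos t ht).ne')), pd_rpow_const hd (hpos t ht),
      weightedScore, score]
    ring
  rw [eqOn_pd hs hfirst j hθ, pd_const_mul (differentiableAt_weightedScore hs hf hpos hθ i)]
  ring

end WeightedScore

section MatrixIntegral

variable {𝒳 ι : Type*} [MeasurableSpace 𝒳] [Fintype ι] [DecidableEq ι] {ν : Measure 𝒳}
  {m : 𝒳 → Matrix ι ι ℝ}

lemma integrable_toEuclideanCLM (hm : ∀ i j, Integrable (fun x => m x i j) ν) :
    Integrable (fun x => Matrix.toEuclideanCLM (𝕜 := ℝ) (m x)) ν := by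
  let L : (ι → ι → ℝ) →L[ℝ] (EuclideanSpace ℝ ι →L[ℝ] EuclideanSpace ℝ ι) :=
    LinearMap.toContinuousLinearMap <|
      (Matrix.toEuclideanCLM (n := ι) (𝕜 := ℝ)).toAlgEquiv.toLinearMap
        ∘ₗ (Matrix.ofLinearEquiv ℝ).toLinearMap
  have hm' : Integrable (fun x i j => m x i j) ν :=
    Integrable.of_eval fun i => Integrable.of_eval fun j => hm i j
  exact L.integrable_comp hm'

lemma integral_toEuclideanCLM (hm : ∀ i j, Integrable (fun x => m x i j) ν) :
    ∫ x, Matrix.toEuclideanCLM (𝕜 := ℝ) (m x) ∂ν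
      = Matrix.toEuclideanCLM (𝕜 := ℝ) (Matrix.of fun i j => ∫ x, m x i j ∂ν) := by
  ext v i
  have hv := (integrable_toEuclideanCLM hm).apply_continuousLinearMap v
  rw [ContinuousLinearMap.integral_apply (integrable_toEuclideanCLM hm), eval_integral_piLp
    fun i => hv.eval_piLp i]
  simp only [Matrix.ofLp_toEuclideanCLM, Matrix.mulVec, dotProduct, Matrix.of_apply]
  rw [integral_finsetSum _ fun j _ => (hm i j).mul_const _]
  simp only [integral_mul_const]

end MatrixIntegral

section Model

variable {p : ℕ} {𝒳 : Type*} [MeasurableSpace 𝒳] {μ : Measure 𝒳} {f : E p → 𝒳 → ℝ} {θ : E p}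
  {β : ℝ}

lemma ae_modelMeasure_iff (hf : Measurable (f θ)) {q : 𝒳 → Prop} :
    (∀ᵐ x ∂modelMeasure μ f θ, q x) ↔ ∀ᵐ x ∂μ, 0 < f θ x → q x := by
  rw [modelMeasure, ae_withDensity_iff hf.ennreal_ofReal]
  simp

lemma integral_modelMeasure (hf : Measurable (f θ)) (hf0 : ∀ x, 0 ≤ f θ x) (φ : 𝒳 → ℝ) :
    ∫ x, φ x ∂modelMeasure μ f θ = ∫ x, φ x * f θ x ∂μ := by
  rw [modelMeasure, integral_withDensity_eq_integral_toReal_smul hf.ennreal_ofReal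
    (ae_of_all _ fun x => ENNReal.ofReal_lt_top)]
  exact integral_congr_ae (ae_of_all _ fun x => by simp [ENNReal.toReal_ofReal (hf0 x), mul_comm])

lemma integrable_modelMeasure_iff (hf : Measurable (f θ)) (hf0 : ∀ x, 0 ≤ f θ x) {φ : 𝒳 → ℝ} :
    Integrable φ (modelMeasure μ f θ) ↔ Integrable (fun x => φ x * f θ x) μ := by
  rw [modelMeasure, integrable_withDensity_iff hf.ennreal_ofReal
    (ae_of_all _ fun x => ENNReal.ofReal_lt_top)]
  simp [ENNReal.toReal_ofReal (hf0 _)]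

lemma measurable_V (hf : Measurable (f θ)) : Measurable (V μ f β θ) := by
  unfold V
  split_ifs
  · exact (Real.measurable_log.comp hf).neg
  · exact measurable_const.sub ((hf.pow_const β).const_mul _)

lemma objective_eq_sampleMean {Ω : Type*} (X : ℕ → Ω → 𝒳) (n : ℕ) (w : Ω) :
    objective μ f β (fun i : Fin n => X i w) = sampleMean X (fun x t => V μ f β t x) n w := by
  ext t
  simp [objective, sampleMean, Finset.sum_range]

section Moments

variable (hβ : 0 ≤ β) (hf : Measurable (f θ)) (hf0 : ∀ x, 0 ≤ f θ x)

include hβ hf hf0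

lemma integral_weightedScore (i : Fin p) :
    ∫ x, weightedScore f β θ x i ∂modelMeasure μ f θ = xi μ f β θ i := by
  simp only [integral_modelMeasure hf hf0, weightedScore_mul_density hβ (hf0 _), xi]

lemma integral_score_mul_weightedScore (i j : Fin p) :
    ∫ x, score f θ x j * weightedScore f β θ x i ∂modelMeasure μ f θ = J μ f β θ i j := by
  simp only [integral_modelMeasure hf hf0, mul_assoc, weightedScore_mul_density hβ (hf0 _), J,
    Matrix.of_apply, mul_left_comm (score f θ _ j)]

lemma integral_weightedScore_mul_weightedScore (i j : Fin p) :
    ∫ x, weightedScore f β θ x i * weightedScore f β θ x j ∂modelMeasure μ f θ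
      = K μ f β θ i j + xi μ f β θ i * xi μ f β θ j := by
  simp only [integral_modelMeasure hf hf0,
    weightedScore_mul_weightedScore_mul_density hβ (hf0 _), K, Matrix.of_apply, sub_add_cancel]

end Moments

/-- The part of the regularity conditions that does not involve `β`: on the open neighbourhood `s`
of `θ₀` the functions `f θ` are probability densities with a common support, and they depend
smoothly on `θ`. -/
structure IsSmoothFamily (μ : Measure 𝒳) (f : E p → 𝒳 → ℝ) (s : Set (E p)) (θ₀ : E p) : Prop where
  isOpen : IsOpen s
  mem : θ₀ ∈ s
  measurable : ∀ θ ∈ s, Measurable (f θ)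
  nonneg : ∀ θ ∈ s, ∀ x, 0 ≤ f θ x
  isProbabilityMeasure : ∀ θ ∈ s, IsProbabilityMeasure (modelMeasure μ f θ)
  common_support : ∀ θ ∈ s, {x | 0 < f θ x} = {x | 0 < f θ₀ x}
  contDiffOn : ∀ᵐ x ∂μ, 0 < f θ₀ x → ContDiffOn ℝ 3 (fun θ => f θ x) s

namespace IsSmoothFamily

variable {s : Set (E p)} {θ₀ : E p}

lemma pos_iff (h : IsSmoothFamily μ f s θ₀) (hθ : θ ∈ s) (x : 𝒳) : 0 < f θ x ↔ 0 < f θ₀ x :=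
  Set.ext_iff.1 (h.common_support θ hθ) x

lemma eq_zero (h : IsSmoothFamily μ f s θ₀) (hθ : θ ∈ s) {x : 𝒳} (hx : f θ₀ x = 0) :
    f θ x = 0 :=
  ((h.nonneg θ hθ x).eq_or_lt.resolve_right fun hpos =>
    ((h.pos_iff hθ x).1 hpos).ne' hx).symm

lemma integral_eq_one (h : IsSmoothFamily μ f s θ₀) (hθ : θ ∈ s) : ∫ x, f θ x ∂μ = 1 := by
  have := h.isProbabilityMeasure θ hθ
  simpa using (integral_modelMeasure (μ := μ) (h.measurable θ hθ) (h.nonneg θ hθ) fun _ => 1).symm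

lemma eqOn_V (h : IsSmoothFamily μ f s θ₀) (x : 𝒳) :
    Set.EqOn (fun t => V μ f β t x)
      (fun t => (∫ y, f t y ^ (1 + β) ∂μ) - observationTerm β (f t x)) s := fun t ht => by
  by_cases hβ : β = 0
  · simp [V, observationTerm, hβ, h.integral_eq_one ht]
  · simp [V, observationTerm, hβ]

lemma ae_contDiffOn (h : IsSmoothFamily μ f s θ₀) :
    ∀ᵐ x ∂modelMeasure μ f θ₀, ContDiffOn ℝ 3 (fun θ => f θ x) s ∧ ∀ θ ∈ s, 0 < f θ x := by
  refine (ae_modelMeasure_iff (h.measurable θ₀ h.mem)).2 ?_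
  filter_upwards [h.contDiffOn] with x hx hpos
  exact ⟨hx hpos, fun θ hθ => (h.pos_iff hθ x).2 hpos⟩

section Integrals

lemma ae_pd_rpow_one_add (h : IsSmoothFamily μ f s θ₀) (hβ : 0 ≤ β) (i : Fin p) :
    ∀ᵐ x ∂μ, pd i (fun t => f t x ^ (1 + β)) θ₀
      = (1 + β) * (weightedScore f β θ₀ x i * f θ₀ x) := by
  filter_upwards [h.contDiffOn] with x hx
  rcases (h.nonneg θ₀ h.mem x).eq_or_lt with h0 | h0
  · have hzero : Set.EqOn (fun t => f t x ^ (1 + β)) (fun _ => 0) s := fun t ht => by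
      simp only [h.eq_zero ht h0.symm, Real.zero_rpow (show 1 + β ≠ 0 by positivity)]
    rw [eqOn_pd h.isOpen hzero i h.mem, pd_const, ← h0, mul_zero, mul_zero]
  · exact pd_density_rpow_one_add h.isOpen (hx h0) (fun t ht => (h.pos_iff ht x).2 h0) h.mem i

lemma ae_pd_pd_rpow_one_add (h : IsSmoothFamily μ f s θ₀) (hβ : 0 ≤ β) (i j : Fin p) :
    ∀ᵐ x ∂μ, pd j (pd i fun t => f t x ^ (1 + β)) θ₀ = (1 + β) *
      ((pd j (fun t => weightedScore f β t x i) θ₀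
        + score f θ₀ x j * weightedScore f β θ₀ x i) * f θ₀ x) := by
  filter_upwards [h.contDiffOn] with x hx
  rcases (h.nonneg θ₀ h.mem x).eq_or_lt with h0 | h0
  · have hzero : Set.EqOn (fun t => f t x ^ (1 + β)) (fun _ => 0) s := fun t ht => by
      simp only [h.eq_zero ht h0.symm, Real.zero_rpow (show 1 + β ≠ 0 by positivity)]
    rw [eqOn_pd h.isOpen (eqOn_pd h.isOpen hzero i) j h.mem, pd_const, pd_const, ← h0, mul_zero,
      mul_zero]
  · exact pd_pd_density_rpow_one_add h.isOpen (hx h0) (fun t ht => (h.pos_iff ht x).2 h0) h.mem i j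

lemma ae_pd_pd_rpow_mul (h : IsSmoothFamily μ f s θ₀) (i j : Fin p) :
    ∀ᵐ x ∂μ, pd j (pd i fun t => f t x ^ β * f θ₀ x) θ₀
      = β * (pd j (fun t => weightedScore f β t x i) θ₀ * f θ₀ x) := by
  filter_upwards [h.contDiffOn] with x hx
  rcases (h.nonneg θ₀ h.mem x).eq_or_lt with h0 | h0
  · simp [← h0, pd_const]
  · exact pd_pd_density_rpow_mul h.isOpen (hx h0) (fun t ht => (h.pos_iff ht x).2 h0) h.mem _ i j

lemma integrable_weightedScore (h : IsSmoothFamily μ f s θ₀) (hβ : 0 ≤ β)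
    (hF : ThriceDiffUnderIntegral μ (fun θ x => f θ x ^ (1 + β)) s) (i : Fin p) :
    Integrable (fun x => weightedScore f β θ₀ x i) (modelMeasure μ f θ₀) := by
  refine (integrable_modelMeasure_iff (h.measurable θ₀ h.mem) (h.nonneg θ₀ h.mem)).2 ?_
  refine ((hF.integrable₁ θ₀ h.mem i).const_mul (1 + β)⁻¹).congr ?_
  filter_upwards [h.ae_pd_rpow_one_add hβ i] with x hx
  rw [hx, inv_mul_cancel_left₀ (by positivity)]

lemma memLp_weightedScore (h : IsSmoothFamily μ f s θ₀) (hβ : 0 ≤ β)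
    (hF : ThriceDiffUnderIntegral μ (fun θ x => f θ x ^ (1 + β)) s)
    (hK : ∀ i j, Integrable
      (fun x => score f θ₀ x i * score f θ₀ x j * f θ₀ x ^ (1 + 2 * β)) μ) (i : Fin p) :
    MemLp (fun x => weightedScore f β θ₀ x i) 2 (modelMeasure μ f θ₀) := by
  have hf0 := h.nonneg θ₀ h.mem
  refine (memLp_two_iff_integrable_sq
    (h.integrable_weightedScore hβ hF i).aestronglyMeasurable).2 ?_
  refine (integrable_modelMeasure_iff (h.measurable θ₀ h.mem) hf0).2 ((hK i i).congr ?_)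
  refine ae_of_all _ fun x => ?_
  simp only [sq, weightedScore_mul_weightedScore_mul_density hβ (hf0 x)]

lemma integrable_pd_weightedScore_add (h : IsSmoothFamily μ f s θ₀) (hβ : 0 ≤ β)
    (hF : ThriceDiffUnderIntegral μ (fun θ x => f θ x ^ (1 + β)) s) (i j : Fin p) :
    Integrable (fun x => pd j (fun t => weightedScore f β t x i) θ₀
      + score f θ₀ x j * weightedScore f β θ₀ x i) (modelMeasure μ f θ₀) := by
  refine (integrable_modelMeasure_iff (h.measurable θ₀ h.mem) (h.nonneg θ₀ h.mem)).2 ?_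
  refine ((hF.integrable₂ θ₀ h.mem j i).const_mul (1 + β)⁻¹).congr ?_
  filter_upwards [h.ae_pd_pd_rpow_one_add hβ i j] with x hx
  rw [hx, inv_mul_cancel_left₀ (by positivity)]

lemma integrable_pd_weightedScore (h : IsSmoothFamily μ f s θ₀) (hβ : 0 ≤ β)
    (hF : ThriceDiffUnderIntegral μ (fun θ x => f θ x ^ (1 + β)) s)
    (hG : ThriceDiffUnderIntegral μ (fun θ x => f θ x ^ β * f θ₀ x) s)
    (hK : ∀ i j, Integrable
      (fun x => score f θ₀ x i * score f θ₀ x j * f θ₀ x ^ (1 + 2 * β)) μ) (i j : Fin p) :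
    Integrable (fun x => pd j (fun t => weightedScore f β t x i) θ₀) (modelMeasure μ f θ₀) := by
  have hfm := h.measurable θ₀ h.mem
  have hf0 := h.nonneg θ₀ h.mem
  rcases eq_or_ne β 0 with rfl | hβ0
  · -- For `β = 0` the function `f_θ^β f_θ₀` does not depend on `θ`, but then `∫ u uᵀ f` is finite
    -- by `hK`.
    have hscore : Integrable (fun x => score f θ₀ x j * weightedScore f 0 θ₀ x i)
        (modelMeasure μ f θ₀) :=
      (integrable_modelMeasure_iff hfm hf0).2 <| by simpa [weightedScore] using hK j i
    exact ((h.integrable_pd_weightedScore_add hβ hF i j).sub hscore).congr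
      (ae_of_all _ fun x => add_sub_cancel_right _ _)
  · refine (integrable_modelMeasure_iff hfm hf0).2 ?_
    refine ((hG.integrable₂ θ₀ h.mem j i).const_mul β⁻¹).congr ?_
    filter_upwards [h.ae_pd_pd_rpow_mul i j] with x hx
    rw [hx, inv_mul_cancel_left₀ hβ0]

lemma pd_integral_rpow_one_add (h : IsSmoothFamily μ f s θ₀) (hβ : 0 ≤ β)
    (hF : ThriceDiffUnderIntegral μ (fun θ x => f θ x ^ (1 + β)) s) (i : Fin p) :
    pd i (fun t => ∫ x, f t x ^ (1 + β) ∂μ) θ₀ = (1 + β) * xi μ f β θ₀ i := by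
  have hfm := h.measurable θ₀ h.mem
  have hf0 := h.nonneg θ₀ h.mem
  rw [hF.deriv₁ θ₀ h.mem i, integral_congr_ae (h.ae_pd_rpow_one_add hβ i), integral_const_mul,
    ← integral_modelMeasure hfm hf0, integral_weightedScore hβ hfm hf0]

lemma pd_pd_integral_rpow_one_add (h : IsSmoothFamily μ f s θ₀) (hβ : 0 ≤ β)
    (hF : ThriceDiffUnderIntegral μ (fun θ x => f θ x ^ (1 + β)) s)
    (hG : ThriceDiffUnderIntegral μ (fun θ x => f θ x ^ β * f θ₀ x) s)
    (hK : ∀ i j, Integrable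
      (fun x => score f θ₀ x i * score f θ₀ x j * f θ₀ x ^ (1 + 2 * β)) μ) (i j : Fin p) :
    pd j (pd i fun t => ∫ x, f t x ^ (1 + β) ∂μ) θ₀
      = (1 + β) * ((∫ x, pd j (fun t => weightedScore f β t x i) θ₀ ∂modelMeasure μ f θ₀)
          + J μ f β θ₀ i j) := by
  have hfm := h.measurable θ₀ h.mem
  have hf0 := h.nonneg θ₀ h.mem
  have hpd := h.integrable_pd_weightedScore hβ hF hG hK i j
  have hscore : Integrable (fun x => score f θ₀ x j * weightedScore f β θ₀ x i)
      (modelMeasure μ f θ₀) :=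
    ((h.integrable_pd_weightedScore_add hβ hF i j).sub hpd).congr
      (ae_of_all _ fun x => add_sub_cancel_left _ _)
  rw [hF.deriv₂ θ₀ h.mem j i, integral_congr_ae (h.ae_pd_pd_rpow_one_add hβ i j),
    integral_const_mul, ← integral_modelMeasure hfm hf0, integral_add hpd hscore,
    integral_score_mul_weightedScore hβ hfm hf0]

end Integrals

end IsSmoothFamily

end Model

section Criterion

variable {p : ℕ} {𝒳 : Type*} [MeasurableSpace 𝒳] {μ : Measure 𝒳} {f : E p → 𝒳 → ℝ} {β : ℝ}
  {s : Set (E p)} {θ₀ : E p}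

lemma ThriceDiffUnderIntegral.thriceDifferentiableOn {F : E p → 𝒳 → ℝ}
    (h : ThriceDiffUnderIntegral μ F s) :
    ThriceDifferentiableOn (fun t => ∫ x, F t x ∂μ) s :=
  ⟨h.differentiable₁, h.differentiable₂, h.differentiable₃⟩

namespace IsSmoothFamily

lemma thriceDifferentiableOn_observationTerm (h : IsSmoothFamily μ f s θ₀) :
    ∀ᵐ x ∂modelMeasure μ f θ₀,
      ThriceDifferentiableOn (fun t => observationTerm β (f t x)) s := by
  filter_upwards [h.ae_contDiffOn] with x hx
  exact .of_contDiffOn h.isOpen (contDiffOn_observationTerm hx.1 hx.2)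

variable (h : IsSmoothFamily μ f s θ₀)
  (hF : ThriceDiffUnderIntegral μ (fun θ x => f θ x ^ (1 + β)) s)

include h hF

lemma thriceDifferentiableOn_V :
    ∀ᵐ x ∂modelMeasure μ f θ₀, ThriceDifferentiableOn (fun t => V μ f β t x) s := by
  filter_upwards [h.thriceDifferentiableOn_observationTerm (β := β)] with x hx
  exact (hF.thriceDifferentiableOn.sub h.isOpen hx).congr h.isOpen (h.eqOn_V x)

lemma ae_pd_V (hβ : 0 ≤ β) (i : Fin p) :
    ∀ᵐ x ∂modelMeasure μ f θ₀, pd i (fun t => V μ f β t x) θ₀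
      = (1 + β) * (xi μ f β θ₀ i - weightedScore f β θ₀ x i) := by
  filter_upwards [h.ae_contDiffOn, h.thriceDifferentiableOn_observationTerm (β := β)]
    with x hx hobs
  have hd := (hx.1.contDiffAt (h.isOpen.mem_nhds h.mem)).differentiableAt (by norm_num)
  calc pd i (fun t => V μ f β t x) θ₀
      = pd i (fun t => ∫ y, f t y ^ (1 + β) ∂μ) θ₀ - pd i (fun t => observationTerm β (f t x)) θ₀ :=
        (eqOn_pd h.isOpen (h.eqOn_V x) i h.mem).trans
          (hF.thriceDifferentiableOn.eqOn_pd_sub h.isOpen hobs i h.mem)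
    _ = (1 + β) * (xi μ f β θ₀ i - weightedScore f β θ₀ x i) := by
        rw [h.pd_integral_rpow_one_add hβ hF, pd_observationTerm hd (hx.2 θ₀ h.mem), mul_sub]

lemma ae_pd_pd_V (i j : Fin p) :
    ∀ᵐ x ∂modelMeasure μ f θ₀, pd j (pd i fun t => V μ f β t x) θ₀
      = pd j (pd i fun t => ∫ y, f t y ^ (1 + β) ∂μ) θ₀
        - (1 + β) * pd j (fun t => weightedScore f β t x i) θ₀ := by
  filter_upwards [h.ae_contDiffOn, h.thriceDifferentiableOn_observationTerm (β := β)]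
    with x hx hobs
  rw [← pd_pd_observationTerm h.isOpen hx.1 hx.2 h.mem]
  exact (eqOn_pd h.isOpen (eqOn_pd h.isOpen (h.eqOn_V x) i) j h.mem).trans
    (hF.thriceDifferentiableOn.eqOn_pd_pd_sub h.isOpen hobs j i h.mem)

section Gradient

lemma ae_gradient_V (hβ : 0 ≤ β) : ∀ᵐ x ∂modelMeasure μ f θ₀, ∀ i,
    ∇ (fun t => V μ f β t x) θ₀ i = (1 + β) * (xi μ f β θ₀ i - weightedScore f β θ₀ x i) :=
  ae_all_iff.2 fun i => by simpa only [gradient_apply] using h.ae_pd_V hF hβ i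

lemma integral_gradient_V (hβ : 0 ≤ β) :
    ∫ x, ∇ (fun t => V μ f β t x) θ₀ ∂modelMeasure μ f θ₀ = 0 := by
  have := h.isProbabilityMeasure θ₀ h.mem
  have hcentred : ∀ i, Integrable (fun x => (1 + β) * (xi μ f β θ₀ i - weightedScore f β θ₀ x i))
      (modelMeasure μ f θ₀) := fun i =>
    ((integrable_const _).sub (h.integrable_weightedScore hβ hF i)).const_mul _
  have hae : ∀ i, (fun x => ∇ (fun t => V μ f β t x) θ₀ i)
      =ᵐ[modelMeasure μ f θ₀] fun x => (1 + β) * (xi μ f β θ₀ i - weightedScore f β θ₀ x i) :=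
    fun i => (h.ae_gradient_V hF hβ).mono fun x hx => hx i
  ext i
  rw [eval_integral_piLp fun i => (hcentred i).congr (hae i).symm, integral_congr_ae (hae i),
    integral_const_mul, integral_sub (integrable_const _) (h.integrable_weightedScore hβ hF i),
    integral_const, integral_weightedScore hβ (h.measurable θ₀ h.mem) (h.nonneg θ₀ h.mem)]
  simp

variable (hβ : 0 ≤ β) (hK : ∀ i j, Integrable
    (fun x => score f θ₀ x i * score f θ₀ x j * f θ₀ x ^ (1 + 2 * β)) μ)

include hβ hK

lemma memLp_gradient_V :
    MemLp (fun x => ∇ (fun t => V μ f β t x) θ₀) 2 (modelMeasure μ f θ₀) := by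
  have := h.isProbabilityMeasure θ₀ h.mem
  refine MemLp.of_eval_piLp fun i => ?_
  refine (((memLp_const (xi μ f β θ₀ i)).sub
    (h.memLp_weightedScore hβ hF hK i)).const_mul (1 + β)).ae_eq ?_
  filter_upwards [h.ae_gradient_V hF hβ] with x hx
  exact (hx i).symm

lemma integral_gradient_V_mul_gradient_V (i j : Fin p) :
    ∫ x, ∇ (fun t => V μ f β t x) θ₀ i * ∇ (fun t => V μ f β t x) θ₀ j ∂modelMeasure μ f θ₀
      = ((1 + β) ^ 2 • K μ f β θ₀) i j := by
  have := h.isProbabilityMeasure θ₀ h.mem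
  have hfm := h.measurable θ₀ h.mem
  have hf0 := h.nonneg θ₀ h.mem
  set ν := modelMeasure μ f θ₀ with hν
  set ψ : Fin p → 𝒳 → ℝ := fun i x => weightedScore f β θ₀ x i
  set ξ := xi μ f β θ₀
  have hψ : ∀ i, MemLp (ψ i) 2 ν := h.memLp_weightedScore hβ hF hK
  have hmean : ∀ i, ∫ x, ψ i x ∂ν = ξ i := integral_weightedScore hβ hfm hf0
  have hcov : cov[ψ i, ψ j; ν] = K μ f β θ₀ i j := by
    rw [covariance_eq_sub (hψ i) (hψ j), hmean, hmean]
    simp only [Pi.mul_apply, ψ, hν, integral_weightedScore_mul_weightedScore hβ hfm hf0,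
      add_sub_cancel_right, ξ]
  calc ∫ x, ∇ (fun t => V μ f β t x) θ₀ i * ∇ (fun t => V μ f β t x) θ₀ j ∂ν
      = ∫ x, (1 + β) ^ 2 * ((ψ i x - ξ i) * (ψ j x - ξ j)) ∂ν := by
        refine integral_congr_ae ?_
        filter_upwards [h.ae_gradient_V hF hβ] with x hx
        simp only [hx, ψ, ξ]
        ring
    _ = ((1 + β) ^ 2 • K μ f β θ₀) i j := by
        rw [integral_const_mul, ← hmean i, ← hmean j, ← covariance, hcov, Matrix.smul_apply,
          smul_eq_mul]

end Gradient

section Hessian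

variable (hβ : 0 ≤ β) (hG : ThriceDiffUnderIntegral μ (fun θ x => f θ x ^ β * f θ₀ x) s)
  (hK : ∀ i j, Integrable
    (fun x => score f θ₀ x i * score f θ₀ x j * f θ₀ x ^ (1 + 2 * β)) μ)

include hβ hG hK

lemma integrable_hessian_V (i j : Fin p) :
    Integrable (fun x => hessian (fun t => V μ f β t x) θ₀ i j) (modelMeasure μ f θ₀) := by
  have := h.isProbabilityMeasure θ₀ h.mem
  refine ((integrable_const (pd j (pd i fun t => ∫ y, f t y ^ (1 + β) ∂μ) θ₀)).sub
    ((h.integrable_pd_weightedScore hβ hF hG hK i j).const_mul (1 + β))).congr ?_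
  filter_upwards [h.ae_pd_pd_V hF i j] with x hx
  exact hx.symm

lemma integral_hessian_V (i j : Fin p) :
    ∫ x, hessian (fun t => V μ f β t x) θ₀ i j ∂modelMeasure μ f θ₀
      = ((1 + β) • J μ f β θ₀) i j := by
  have := h.isProbabilityMeasure θ₀ h.mem
  have hpd := (h.integrable_pd_weightedScore hβ hF hG hK i j).const_mul (1 + β)
  simp only [hessian, Matrix.of_apply]
  rw [integral_congr_ae (h.ae_pd_pd_V hF i j), integral_sub (integrable_const _) hpd,
    integral_const, integral_const_mul, h.pd_pd_integral_rpow_one_add hβ hF hG hK, probReal_univ,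
    one_smul, mul_add, add_sub_cancel_left, Matrix.smul_apply, smul_eq_mul]

lemma regularCriterion_V {ρ : ℝ} (hρ : 0 < ρ) (hρs : ball θ₀ ρ ⊆ s)
    {M : Fin p → Fin p → Fin p → 𝒳 → ℝ}
    (hM : ∀ᵐ x ∂modelMeasure μ f θ₀, ∀ θ ∈ s, ∀ j k l,
      |pd j (pd k (pd l fun t => V μ f β t x)) θ| ≤ M j k l x)
    (hM_int : ∀ j k l, Integrable (M j k l) (modelMeasure μ f θ₀)) :
    RegularCriterion (modelMeasure μ f θ₀) (fun x t => V μ f β t x) θ₀ ρ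
      (fun x => ∇ (fun t => V μ f β t x) θ₀)
      (fun x => Matrix.toEuclideanCLM (𝕜 := ℝ) (hessian (fun t => V μ f β t x) θ₀))
      (fun x => ∑ l, ∑ k, ∑ j, M j k l x)
      ((1 + β) • Matrix.toEuclideanCLM (𝕜 := ℝ) (J μ f β θ₀)) where
  pos := hρ
  quadApprox := by
    filter_upwards [h.thriceDifferentiableOn_V hF, hM] with x hx hMx
    exact quadApprox_of_abs_pd_pd_pd_le (hx.differentiableOn.mono hρs)
      (fun l => (hx.pd l).mono hρs) (fun k l => (hx.pd_pd k l).mono hρs)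
      fun θ hθ => hMx θ (hρs hθ)
  memLp := h.memLp_gradient_V hF hβ hK
  integral_gradient := h.integral_gradient_V hF hβ
  integrable_hessian := integrable_toEuclideanCLM (h.integrable_hessian_V hF hβ hG hK)
  integral_hessian := by
    rw [integral_toEuclideanCLM (h.integrable_hessian_V hF hβ hG hK), ← map_smul]
    congr 1
    ext i j
    exact h.integral_hessian_V hF hβ hG hK i j
  integrable_bound := integrable_finsetSum _ fun l _ => integrable_finsetSum _ fun k _ =>
    integrable_finsetSum _ fun j _ => hM_int j k l

end Hessian

end IsSmoothFamily

end Criterion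

section RestrictedEstimator

variable {p r : ℕ} {𝒳 : Type*} [MeasurableSpace 𝒳] {μ : Measure 𝒳} {Θ : Set (E p)}
  {f : E p → 𝒳 → ℝ} {g : E p → E r} {β : ℝ} {θ₀ : E p}

lemma LehmannBasuConditions.exists_regularCriterion (h : LehmannBasuConditions Θ μ f β θ₀)
    (hf : ∀ θ ∈ Θ, Measurable (f θ)) (hf0 : ∀ θ ∈ Θ, ∀ x, 0 ≤ f θ x)
    (hprob : ∀ θ ∈ Θ, IsProbabilityMeasure (modelMeasure μ f θ)) (hβ : 0 ≤ β)
    (hK : ∀ i j, Integrable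
      (fun x => score f θ₀ x i * score f θ₀ x j * f θ₀ x ^ (1 + 2 * β)) μ) :
    ∃ ρ z H b, ball θ₀ ρ ⊆ Θ ∧
      RegularCriterion (modelMeasure μ f θ₀) (fun x t => V μ f β t x) θ₀ ρ z H b
        ((1 + β) • Matrix.toEuclideanCLM (𝕜 := ℝ) (J μ f β θ₀)) ∧
      ∀ i j, ∫ x, z x i * z x j ∂modelMeasure μ f θ₀ = ((1 + β) ^ 2 • K μ f β θ₀) i j := by
  obtain ⟨s, hs, hsΘ, hθ₀, hsmooth, hF, hG, M, hM, hM_int⟩ := h.smooth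
  have hfam : IsSmoothFamily μ f s θ₀ :=
    { isOpen := hs
      mem := hθ₀
      measurable := fun θ hθ => hf θ (hsΘ hθ)
      nonneg := fun θ hθ => hf0 θ (hsΘ hθ)
      isProbabilityMeasure := fun θ hθ => hprob θ (hsΘ hθ)
      common_support := fun θ hθ => h.common_support θ (hsΘ hθ)
      contDiffOn := hsmooth }
  obtain ⟨ρ, hρ, hρs⟩ := Metric.isOpen_iff.1 hs θ₀ hθ₀
  exact ⟨ρ, _, _, _, hρs.trans hsΘ, hfam.regularCriterion_V hF hβ hG hK hρ hρs
    ((ae_modelMeasure_iff (hfam.measurable θ₀ hθ₀)).2 hM) hM_int,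
    hfam.integral_gradient_V_mul_gradient_V hF hβ hK⟩

lemma isBorderedInverse_P (hg : DifferentiableAt ℝ g θ₀) (hrank : (G g θ₀).rank = r)
    (hJ : (J μ f β θ₀).PosDef) :
    IsBorderedInverse (fderiv ℝ g θ₀) (Matrix.toEuclideanCLM (𝕜 := ℝ) (J μ f β θ₀))
      (Matrix.toEuclideanCLM (𝕜 := ℝ) (P μ f β g θ₀))
      (Matrix.toEuclideanLin (Q μ f β g θ₀)).toContinuousLinearMap :=
  fderiv_eq_toEuclideanLin_transpose hg ▸ isBorderedInverse_toEuclidean hJ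
    (mulVec_injective_of_rank_eq_card (by simpa using hrank)) rfl rfl

lemma smul_P_mul_smul_K_mul_transpose (hJ : (J μ f β θ₀).PosDef) {c : ℝ} (hc : c ≠ 0) :
    (c⁻¹ • P μ f β g θ₀) * (c ^ 2 • K μ f β θ₀) * (c⁻¹ • P μ f β g θ₀).transpose
      = asymptoticCov μ f β g θ₀ := by
  have hP : (P μ f β g θ₀).transpose = P μ f β g θ₀ :=
    isHermitian_inv_sub (B := G g θ₀) hJ.isHermitian rfl rfl
  rw [Matrix.transpose_smul, hP, asymptoticCov]
  simp only [Matrix.smul_mul, Matrix.mul_smul, smul_smul]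
  rw [show c⁻¹ * (c ^ 2 * c⁻¹) = 1 by field_simp, one_smul]

lemma RegularCriterion.asymptoticallyNormal_restricted {Ω : Type*} [MeasurableSpace Ω]
    {Pr : Measure Ω} [IsProbabilityMeasure Pr] {X : ℕ → Ω → 𝒳} {ν : Measure 𝒳}
    {v : 𝒳 → E p → ℝ} {ρ c : ℝ} {z : 𝒳 → E p} {H : 𝒳 → E p →L[ℝ] E p} {b : 𝒳 → ℝ}
    (h : RegularCriterion ν v θ₀ ρ z H b (c • Matrix.toEuclideanCLM (𝕜 := ℝ) (J μ f β θ₀)))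
    (hc : c ≠ 0) (hz : ∀ i j, ∫ x, z x i * z x j ∂ν = (c ^ 2 • K μ f β θ₀) i j)
    (hX : IsIIDSample Pr X ν) (hΘ : Θ ∈ 𝓝 θ₀) (hg : ContDiffAt ℝ 1 g θ₀) (hθ₀ : g θ₀ = 0)
    (hrank : (G g θ₀).rank = r) (hJ : (J μ f β θ₀).PosDef) {est : ℕ → Ω → E p}
    (hmeas : ∀ n, AEMeasurable (est n) Pr)
    (hest : WithHighProbability Pr fun n w =>
      est n w ∈ restricted Θ g ∧ IsLocalMinOn (sampleMean X v n w) (restricted Θ g) (est n w))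
    (hcons : TendstoInMeasure Pr est atTop fun _ => θ₀) :
    AsymptoticallyNormal Pr est θ₀ (asymptoticCov μ f β g θ₀) := by
  refine h.asymptoticallyNormal hX hΘ hg hθ₀
    ((isBorderedInverse_P (hg.differentiableAt one_ne_zero) hrank hJ).smul hc) (fun i j => ?_)
    hmeas hest hcons
  rw [← smul_P_mul_smul_K_mul_transpose hJ hc, ← map_smul]
  exact integral_toEuclideanCLM_mul_toEuclideanCLM h.memLp hz i j

lemma isLocalMinOn_of_isMinOn_inter_closedBall {F : Type*} [PseudoMetricSpace F] {φ : F → ℝ}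
    {S : Set F} {t t₀ : F} {ρ : ℝ} (h : IsMinOn φ (S ∩ closedBall t₀ ρ) t) (ht : t ∈ ball t₀ ρ) :
    IsLocalMinOn φ S t := by
  have hloc := h.localize
  have hnhds : closedBall t₀ ρ ∈ 𝓝 t :=
    mem_of_superset (isOpen_ball.mem_nhds ht) ball_subset_closedBall
  rwa [IsLocalMinOn, nhdsWithin_inter_of_mem' (mem_nhdsWithin_of_mem_nhds hnhds)] at hloc

lemma WithHighProbability.isLocalMinOn_of_isMinOn_inter_closedBall {Ω F : Type*}
    [MeasurableSpace Ω] [SeminormedAddCommGroup F] {Pr : Measure Ω}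
    {φ : ℕ → Ω → F → ℝ} {S : Set F} {est : ℕ → Ω → F} {t₀ : F} {ρ : ℝ}
    (h : WithHighProbability Pr fun n w =>
      est n w ∈ S ∩ closedBall t₀ ρ ∧ IsMinOn (φ n w) (S ∩ closedBall t₀ ρ) (est n w))
    (hcons : TendstoInMeasure Pr est atTop fun _ => t₀) (hρ : 0 < ρ) :
    WithHighProbability Pr fun n w => est n w ∈ S ∧ IsLocalMinOn (φ n w) S (est n w) :=
  (h.and (withHighProbability_of_eventually_nhds hcons (ball_mem_nhds t₀ hρ))).mono
    fun _ _ hw => ⟨hw.1.1.1, DPD.isLocalMinOn_of_isMinOn_inter_closedBall hw.1.2 hw.2⟩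

end RestrictedEstimator

end DPD

end

theorem theorem2_general {p r : ℕ} {𝒳 : Type*} [MeasurableSpace 𝒳] (μ : Measure 𝒳)
    (Θ : Set (DPD.E p)) (f : DPD.E p → 𝒳 → ℝ) (hf : ∀ θ ∈ Θ, Measurable (f θ))
    (hf0 : ∀ θ ∈ Θ, ∀ x, 0 ≤ f θ x)
    (hprob : ∀ θ ∈ Θ, IsProbabilityMeasure (DPD.modelMeasure μ f θ))
    (g : DPD.E p → DPD.E r) (hg : ContDiffOn ℝ 1 g Θ)
    (β : ℝ) (hβ : 0 ≤ β) (θ₀ : DPD.E p) (hθ₀ : θ₀ ∈ DPD.restricted Θ g)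
    (hrank : (DPD.G g θ₀).rank = r)
    (hLB : DPD.LehmannBasuConditions Θ μ f β θ₀)
    (hK : ∀ i j, Integrable
      (fun x => DPD.score f θ₀ x i * DPD.score f θ₀ x j * f θ₀ x ^ (1 + 2 * β)) μ)
    {Ω : Type*} [MeasurableSpace Ω] (Pr : Measure Ω) [IsProbabilityMeasure Pr]
    (X : ℕ → Ω → 𝒳) (hX : DPD.IsIIDSample Pr X (DPD.modelMeasure μ f θ₀)) :
    (∃ ρ₀ > 0, ∀ ρ, 0 < ρ → ρ ≤ ρ₀ →
      (∃ T : ∀ n : ℕ, (Fin n → 𝒳) → DPD.E p, (∀ n, Measurable (T n)) ∧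
        DPD.WithHighProbability Pr (fun n w =>
          T n (fun i => X i w) ∈ DPD.restricted Θ g ∩ Metric.closedBall θ₀ ρ ∧
          IsMinOn (DPD.objective μ f β (fun i : Fin n => X i w))
            (DPD.restricted Θ g ∩ Metric.closedBall θ₀ ρ) (T n (fun i => X i w)))) ∧
      ∀ est : ℕ → Ω → DPD.E p, (∀ n, AEMeasurable (est n) Pr) →
        DPD.WithHighProbability Pr (fun n w =>
          est n w ∈ DPD.restricted Θ g ∩ Metric.closedBall θ₀ ρ ∧
          IsMinOn (DPD.objective μ f β (fun i : Fin n => X i w))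
            (DPD.restricted Θ g ∩ Metric.closedBall θ₀ ρ) (est n w)) →
        TendstoInMeasure Pr est atTop (fun _ => θ₀) ∧
        DPD.AsymptoticallyNormal Pr est θ₀ (DPD.asymptoticCov μ f β g θ₀)) ∧
    (∀ est : ℕ → Ω → DPD.E p, (∀ n, AEMeasurable (est n) Pr) →
      DPD.WithHighProbability Pr (fun n w =>
        est n w ∈ DPD.restricted Θ g ∧
        IsLocalMinOn (DPD.objective μ f β (fun i : Fin n => X i w))
          (DPD.restricted Θ g) (est n w)) →
      TendstoInMeasure Pr est atTop (fun _ => θ₀) →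
      DPD.AsymptoticallyNormal Pr est θ₀ (DPD.asymptoticCov μ f β g θ₀)) := by
  obtain ⟨ρ₁, z, H, b, hρ₁, hreg, hz⟩ := hLB.exists_regularCriterion hf hf0 hprob hβ hK
  have hΘ : Θ ∈ 𝓝 θ₀ := mem_of_superset (Metric.ball_mem_nhds θ₀ hreg.pos) hρ₁
  have hβ1 : 0 < 1 + β := by positivity
  simp only [DPD.objective_eq_sampleMean]
  have normality := fun est => hreg.asymptoticallyNormal_restricted hβ1.ne' hz hX hΘ
    (hg.contDiffAt hΘ) hθ₀.2 hrank hLB.posDef (est := est)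
  obtain ⟨m, hm, hJ⟩ := DPD.exists_pos_mul_sq_norm_le_inner fun d hd =>
    DPD.inner_toEuclideanCLM_pos (hLB.posDef.smul hβ1) hd
  obtain ⟨ρ₀, hρ₀, hcons⟩ := hreg.exists_tendstoInMeasure_of_le hX hm (by simpa using hJ)
  refine ⟨⟨ρ₀, hρ₀.1, fun ρ hρ hρle => ⟨?_, fun est hmeas hest => ?_⟩⟩, normality⟩
  · have hρball : Metric.closedBall θ₀ ρ ⊆ Metric.ball θ₀ ρ₁ :=
      Metric.closedBall_subset_ball (hρle.trans_lt hρ₀.2)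
    exact DPD.exists_measurable_isMinOn_sampleMean
      (DPD.isCompact_restricted_inter_closedBall hg.continuousOn (hρball.trans hρ₁))
      ⟨θ₀, hθ₀, Metric.mem_closedBall_self hρ.le⟩ (fun θ hθ => DPD.measurable_V (hf θ hθ.1.1))
      (hreg.quadApprox.mono fun x hx =>
        hx.contDiffOn.continuousOn.mono (Set.inter_subset_right.trans hρball)) hX.hasLaw
  · have hest_cons : TendstoInMeasure Pr est atTop fun _ => θ₀ :=
      hcons est <| hest.mono fun n w hw => ⟨Metric.closedBall_subset_closedBall hρle hw.1.2,
        hw.2 ⟨hθ₀, Metric.mem_closedBall_self hρ.le⟩⟩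
    exact ⟨hest_cons, normality est hmeas
      (hest.isLocalMinOn_of_isMinOn_inter_closedBall hest_cons hρ) hest_cons⟩

theorem theorem2 {p r : ℕ} (hrp : r < p)
    {𝒳 : Type*} [MeasurableSpace 𝒳] (μ : Measure 𝒳) [SigmaFinite μ]
    (Θ : Set (DPD.E p)) (f : DPD.E p → 𝒳 → ℝ) (hmodel : DPD.IsParametricModel Θ μ f)
    (g : DPD.E p → DPD.E r) (hg : ContDiffOn ℝ 1 g Θ)
    (hrank : ∀ θ ∈ Θ, (DPD.G g θ).rank = r)
    (β : ℝ) (hβ : 0 ≤ β)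
    (θ₀ : DPD.E p) (hθ₀ : θ₀ ∈ DPD.restricted Θ g)
    (hLB : DPD.LehmannBasuConditions Θ μ f β θ₀)
    -- the integrals that define `K_β(θ₀)` exist
    (hK : ∀ i j, Integrable
      (fun x => DPD.score f θ₀ x i * DPD.score f θ₀ x j * f θ₀ x ^ (1 + 2 * β)) μ)
    {Ω : Type*} [MeasurableSpace Ω] (Pr : Measure Ω) [IsProbabilityMeasure Pr]
    (X : ℕ → Ω → 𝒳) (hX : ∀ i, Measurable (X i)) (hindep : iIndepFun X Pr)
    (hlaw : ∀ i, Pr.map (X i) = DPD.modelMeasure μ f θ₀) :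
    -- near `θ₀` restricted minimizers exist, and all of them are consistent and asymptotically
    -- normal
    (∃ ρ₀ > 0, ∀ ρ, 0 < ρ → ρ ≤ ρ₀ →
      (∃ T : ∀ n : ℕ, (Fin n → 𝒳) → DPD.E p, (∀ n, Measurable (T n)) ∧
        DPD.WithHighProbability Pr (fun n w =>
          T n (fun i => X i w) ∈ DPD.restricted Θ g ∩ Metric.closedBall θ₀ ρ ∧
          IsMinOn (DPD.objective μ f β (fun i : Fin n => X i w))
            (DPD.restricted Θ g ∩ Metric.closedBall θ₀ ρ) (T n (fun i => X i w)))) ∧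
      ∀ est : ℕ → Ω → DPD.E p, (∀ n, AEMeasurable (est n) Pr) →
        DPD.WithHighProbability Pr (fun n w =>
          est n w ∈ DPD.restricted Θ g ∩ Metric.closedBall θ₀ ρ ∧
          IsMinOn (DPD.objective μ f β (fun i : Fin n => X i w))
            (DPD.restricted Θ g ∩ Metric.closedBall θ₀ ρ) (est n w)) →
        TendstoInMeasure Pr est atTop (fun _ => θ₀) ∧
        DPD.AsymptoticallyNormal Pr est θ₀ (DPD.asymptoticCov μ f β g θ₀)) ∧
    -- every consistent sequence of (local or global) restricted minimizers is asymptotically normal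
    (∀ est : ℕ → Ω → DPD.E p, (∀ n, AEMeasurable (est n) Pr) →
      DPD.WithHighProbability Pr (fun n w =>
        est n w ∈ DPD.restricted Θ g ∧
        IsLocalMinOn (DPD.objective μ f β (fun i : Fin n => X i w))
          (DPD.restricted Θ g) (est n w)) →
      TendstoInMeasure Pr est atTop (fun _ => θ₀) →
      DPD.AsymptoticallyNormal Pr est θ₀ (DPD.asymptoticCov μ f β g θ₀)) :=
  theorem2_general μ Θ f hmodel.measurable hmodel.nonneg hmodel.isProbabilityMeasure g hg β hβ θ₀
    hθ₀ (hrank θ₀ hθ₀.1) hLB hK Pr X ⟨hindep, fun i => ⟨(hX i).aemeasurable, hlaw i⟩⟩
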